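/- \textbf{Theorem (monodromy of polylogarithms).} Let $s\in\mathbb C$ with $\operatorname{Re} s>1$, and for $|w|<1$ let $\mathrm{Li}_s(w)=\sum_{n\ge 1} w^n/n^s$. Let $D^*=\{z\in\mathbb C : |z|<1\}\setminus(-1,0]$. On $D^*$ let $\log$ be the principal logarithm, and let $$(\log z)^{s-1}=e^{(s-1)\,\ell(z)},\qquad e^{\ell(z)}=\log z,\quad \operatorname{Im}\ell(z)\in(\tfrac{\pi}{2},\tfrac{3\pi}{2})$$ (for $\operatorname{Im} z\ge 0$ this is the principal power of $\log z$). For 1-forms $\alpha,\beta$ and a path $\gamma$ parametrized by $[0,1]$, put, whenever the integrals converge, $$\int_\gamma \alpha\,\beta^{s-1}=\int_0^1\frac{1}{\Gamma(s)}\Bigl(\int_t^1\gamma^*\beta\Bigr)^{s-1}\gamma^*\alpha(t),\qquad \int_\gamma\beta^{s-1}=\frac{1}{\Gamma(s)}\Bigl(\int_\gamma\beta\Bigr)^{s-1},$$ and write $[a\to b]$ for the straight path from $a$ to $b$. Let $w\in D^*$ and let $\gamma$ be a piecewise $C^1$ loop based at $w$ in $\mathbb C\setminus\{0,1\}$ about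 $1$, i.e. $\gamma$ is homotopic in $\mathbb C\setminus\{0,1\}$, with fixed end points, to the loop that goes straight from $w$ to $1-\varepsilon$ for some $0<\varepsilon<1$, then once counterclockwise around the circle of radius $\varepsilon$ about $1$, then straight back to $w$. Then the germ of $\mathrm{Li}_s$ at $w$ has an analytic continuation along $\gamma$, and every such continuation ends in the germ at $w$ of $$z\longmapsto \mathrm{Li}_s(z)-\frac{2\pi i}{\Gamma(s)}(\log z)^{s-1}.$$ Moreover, for every $z\in D^*$ the following integrals converge and $$\mathrm{Li}_s(z)-\frac{2\pi i}{\Gamma(s)}(\log z)^{s-1}=\int_{[0\to z]}\frac{dx}{1-x}\Bigl(\frac{dx}{x}\Bigr)^{s-1}+\int_\gamma\frac{dx}{1-x}\cdot\int_{[1\to z]}\Bigl(\frac{dx}{x}\Bigr)^{s-1}.$$ Here the power in the first integral on the right is the principal one (its base $\int_t^1 dx/x$ along $[0\to z]$ is the positive number $-\log t$, $0<t<1$), and in $\int_{[1\to z]}(dx/x)^{s-1}=\frac{1}{\Gamma(s)}(\int_{[1\to z]}dx/x)^{s-1}$ the power is the branch $(\log z)^{s-1}$ above. -/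

import Mathlib

open scoped Topology unitInterval

noncomputable section

/-- The polylogarithm `Li_s(w) = ∑_{n ≥ 1} w ^ n / n ^ s` (convergent for `|w| < 1`). -/
def polylog (s w : ℂ) : ℂ := ∑' n : ℕ, w ^ (n + 1) / ((n + 1 : ℕ) : ℂ) ^ s

/-- The determination of the logarithm whose imaginary part lies in `(θ - π, θ + π]`. -/
def logDet (θ : ℝ) (z : ℂ) : ℂ :=
  Complex.log (z * Complex.exp (-(θ * Complex.I))) + θ * Complex.I

/-- The complex power `z ^ a = exp (a * log z)` for the determination `logDet θ` of the logarithm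
(for `θ = 0` and `z ≠ 0` this is the principal power). -/
def powDet (θ : ℝ) (z a : ℂ) : ℂ := Complex.exp (a * logDet θ z)

/-- The 1-form `dx / x` on `ℂ ∖ {0}`. -/
def formDlog (x : ℂ) : ℂ →L[ℂ] ℂ := x⁻¹ • (1 : ℂ →L[ℂ] ℂ)

/-- The 1-form `dx / (1 - x)` on `ℂ ∖ {1}`. -/
def formOne (x : ℂ) : ℂ →L[ℂ] ℂ := (1 - x)⁻¹ • (1 : ℂ →L[ℂ] ℂ)

/-- The integrand `(1 / Γ(s)) (∫_t^1 γ^*β)^(s-1) γ^*α(t)` of the complex iterated integral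
`∫_γ α β^(s-1)`; the power is taken with the determination `logDet θ` of the logarithm. -/
def iterIntegrand (θ : ℝ) (α β : ℂ → ℂ →L[ℂ] ℂ) {a b : ℂ} (γ : Path a b) (s : ℂ) (t : ℝ) : ℂ :=
  1 / Complex.Gamma s * powDet θ (∫ u in t..1, curveIntegralFun β γ u) (s - 1) *
    curveIntegralFun α γ t

/-- Convergence of the complex iterated integral `∫_γ α β^(s-1)`. -/
def IterIntegrable (θ : ℝ) (α β : ℂ → ℂ →L[ℂ] ℂ) {a b : ℂ} (γ : Path a b) (s : ℂ) : Prop :=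
  (∀ t ∈ Set.Ioo (0 : ℝ) 1, IntervalIntegrable (curveIntegralFun β γ) MeasureTheory.volume t 1) ∧
    IntervalIntegrable (iterIntegrand θ α β γ s) MeasureTheory.volume 0 1

/-- The complex iterated integral
`∫_γ α β^(s-1) = ∫_0^1 (1 / Γ(s)) (∫_t^1 γ^*β)^(s-1) γ^*α(t)`. -/
def iterIntegral (θ : ℝ) (α β : ℂ → ℂ →L[ℂ] ℂ) {a b : ℂ} (γ : Path a b) (s : ℂ) : ℂ :=
  ∫ t in (0 : ℝ)..1, iterIntegrand θ α β γ s t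

/-- The complex iterated integral `∫_γ β^(s-1) = (1 / Γ(s)) (∫_γ β)^(s-1)`. -/
def powIntegral (θ : ℝ) (β : ℂ → ℂ →L[ℂ] ℂ) {a b : ℂ} (γ : Path a b) (s : ℂ) : ℂ :=
  1 / Complex.Gamma s * powDet θ (curveIntegral β γ) (s - 1)

/-- A piecewise continuously differentiable path. -/
def IsPiecewiseC1 {a b : ℂ} (γ : Path a b) : Prop :=
  ∃ (n : ℕ) (τ : ℕ → ℝ), StrictMono τ ∧ τ 0 = 0 ∧ τ n = 1 ∧
    ∀ i < n, ContDiffOn ℝ 1 γ.extend (Set.Icc (τ i) (τ (i + 1)))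

/-- The circle of radius `ε` about `1`, based at `1 - ε`, run through once counterclockwise. -/
def circleAboutOne (ε : ℝ) : Path (1 - ε : ℂ) (1 - ε : ℂ) where
  toFun t := 1 - ε * Complex.exp (2 * Real.pi * (t : ℝ) * Complex.I)
  continuous_toFun := by fun_prop
  source' := by simp
  target' := by simp [Complex.exp_two_pi_mul_I]

/-- The loop `[w → 1 - ε] · (circle of radius ε about 1) · [1 - ε → w]`. -/
def standardLoop (w : ℂ) (ε : ℝ) : Path w w :=
  ((Path.segment w (1 - ε : ℂ)).trans (circleAboutOne ε)).trans (Path.segment (1 - ε : ℂ) w)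

/-- `γ` is a loop about `1` in `ℂ ∖ {0, 1}`: it is homotopic there, with fixed end points, to the
loop which goes straight from `w` to a point `1 - ε` with `0 < ε < 1`, then once counterclockwise
around `1`, and straight back to `w`. -/
def IsLoopAboutOne {w : ℂ} (γ : Path w w) : Prop :=
  ∃ ε ∈ Set.Ioo (0 : ℝ) 1, ∃ H : γ.Homotopy (standardLoop w ε), ∀ p, H p ≠ 0 ∧ H p ≠ 1

/-- `g` is an analytic continuation along `γ`: a family of germs `g t` of analytic functions at the
points `γ t`, such that for `t'` near `t` the germ `g t'` is the one given by `g t` at `γ t'`. -/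
def IsAnalyticContinuationAlong {a b : ℂ} (γ : Path a b) (g : I → ℂ → ℂ) : Prop :=
  (∀ t, AnalyticAt ℂ (g t) (γ t)) ∧ ∀ t, ∀ᶠ t' in 𝓝 t, g t' =ᶠ[𝓝 (γ t')] g t

end

/-!
`Li_s(z) = (1 / Γ(s)) ∫_0^1 (-log t) ^ (s - 1) z / (1 - t z) dt` extends `Li_s` to `ℂ ∖ [1, ∞)`. The
kernel has its pole at `t = z⁻¹`; subtracting from the density its value at this point, and adding
the integral of the kernel alone, which is a logarithm, gives a function that is analytic across
`(1, ∞)`. The density at `t = z⁻¹` is a power of `log z`, and the logarithm changes by `2 π i`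
around `1`: this is the term `-(2 π i / Γ(s)) (log z) ^ (s - 1)`.

The two functions glued across `(1, ∞)` differ by multiples of powers of `log z`, so the germs of
their sums with such multiples extend to a disc about each point of `ℂ ∖ {0, 1}`. The continuation
along `γ` can therefore be moved by a homotopy to the standard loop, where it is read off. The same
two steps, for primitives of `dx / (1 - x)`, give `∫_γ dx / (1 - x) = -2 π i`.
-/

open MeasureTheory Filter Metric Set

/-- The property that every germ of the family `P` at a point of `B` is the germ of an analytic
function on `B` whose germs at all points of `B` belong to the family. A germ at `b` is given by a
representative, and `P b` is the set of germs at `b`. -/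
def GermsExtendOn (P : ℂ → Set (ℂ → ℂ)) (B : Set ℂ) : Prop :=
  ∀ b ∈ B, ∀ f ∈ P b, ∃ F : ℂ → ℂ, AnalyticOnNhd ℂ F B ∧ F =ᶠ[𝓝 b] f ∧ ∀ c ∈ B, F ∈ P c

/-- The property that the germs of the family `P` extend to a disc about each point of `X`: then
they can be continued along all paths in `X`, and `P` generalizes a locally constant sheaf. -/
def GermsExtendLocally (P : ℂ → Set (ℂ → ℂ)) (X : Set ℂ) : Prop :=
  ∀ a ∈ X, ∃ r > 0, GermsExtendOn P (ball a r)

section Extension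

variable {P : ℂ → Set (ℂ → ℂ)} {B B' X : Set ℂ} {a b : ℂ} {f : ℂ → ℂ} {r : ℝ}

theorem GermsExtendOn.mono (hP : GermsExtendOn P B) (h : B' ⊆ B) : GermsExtendOn P B' :=
  fun b hb f hf =>
    let ⟨F, hF, hFf, hFP⟩ := hP b (h hb) f hf
    ⟨F, hF.mono h, hFf, fun c hc => hFP c (h hc)⟩

theorem GermsExtendLocally.analyticAt (hP : GermsExtendLocally P X) (hb : b ∈ X) (hf : f ∈ P b) :
    AnalyticAt ℂ f b := by
  obtain ⟨r, hr, hext⟩ := hP b hb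
  obtain ⟨F, hF, hFf, -⟩ := hext b (mem_ball_self hr) f hf
  exact (hF b (mem_ball_self hr)).congr hFf

/-- The germs of primitives of the 1-form `ω`. -/
def primitiveGerms (ω : ℂ → ℂ →L[ℂ] ℂ) (b : ℂ) : Set (ℂ → ℂ) :=
  {f | ∀ᶠ z in 𝓝 b, HasFDerivAt f (ω z) z}

theorem germsExtendOn_primitiveGerms {ω : ℂ → ℂ →L[ℂ] ℂ} (hω : DifferentiableOn ℂ ω (ball a r)) :
    GermsExtendOn (primitiveGerms ω) (ball a r) := by
  intro b hb f hf
  obtain ⟨F, hFb, hF⟩ :=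
    (hω.clm_apply (differentiableOn_const 1)).isExactOn_ball.with_val_at b (f b)
  have hFω : ∀ z ∈ ball a r, HasFDerivAt F (ω z) z := fun z hz => by
    have hωz : ω z = ContinuousLinearMap.toSpanSingleton ℂ (ω z 1) := by ext; simp
    exact hωz ▸ (hF z hz).hasFDerivAt
  have hFd : DifferentiableOn ℂ F (ball a r) := fun z hz =>
    (hF z hz).differentiableAt.differentiableWithinAt
  obtain ⟨ρ, hρ, hball⟩ := Metric.eventually_nhds_iff_ball.1
    (hf.and (isOpen_ball.eventually_mem hb))
  refine ⟨F, hFd.analyticOnNhd isOpen_ball, eventually_of_mem (ball_mem_nhds b hρ) ?_,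
    fun c hc => eventually_of_mem (isOpen_ball.mem_nhds hc) hFω⟩
  exact isOpen_ball.eqOn_of_fderiv_eq (convex_ball b ρ).isPreconnected
    (hFd.mono fun z hz => (hball z hz).2)
    (fun z hz => (hball z hz).1.differentiableAt.differentiableWithinAt)
    (fun z hz => (hFω z (hball z hz).2).fderiv.trans (hball z hz).1.fderiv.symm)
    (mem_ball_self hρ) hFb

theorem exists_exp_eq_of_differentiableOn_ball (hf : DifferentiableOn ℂ f (ball a r))
    (h0 : ∀ z ∈ ball a r, f z ≠ 0) {v : ℂ} (hb : b ∈ ball a r) (hv : Complex.exp v = f b) :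
    ∃ L : ℂ → ℂ, DifferentiableOn ℂ L (ball a r) ∧ L b = v ∧
      ∀ z ∈ ball a r, Complex.exp (L z) = f z := by
  obtain ⟨L, hLb, hL⟩ := ((hf.deriv isOpen_ball).div hf h0).isExactOn_ball.with_val_at b v
  have hquot : ∀ z ∈ ball a r, HasDerivAt (fun z => Complex.exp (-L z) * f z) 0 z := by
    intro z hz
    convert! (hL z hz).neg.cexp.mul
      (hf.differentiableAt (isOpen_ball.mem_nhds hz)).hasDerivAt using 1
    have := h0 z hz
    simp only [Pi.neg_apply, Pi.div_apply]
    field_simp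
    ring
  refine ⟨L, fun z hz => (hL z hz).differentiableAt.differentiableWithinAt, hLb, fun z hz => ?_⟩
  have hconst : Complex.exp (-L z) * f z = Complex.exp (-L b) * f b :=
    isOpen_ball.is_const_of_deriv_eq_zero (convex_ball a r).isPreconnected
      (fun z hz => (hquot z hz).differentiableAt.differentiableWithinAt)
      (fun z hz => (hquot z hz).deriv) hz hb
  rwa [hLb, ← hv, ← Complex.exp_add, neg_add_cancel, Complex.exp_zero, Complex.exp_neg,
    inv_mul_eq_one₀ (Complex.exp_ne_zero _)] at hconst

theorem eventuallyEq_of_exp_eventuallyEq {X : Type*} [TopologicalSpace X] {L M : X → ℂ} {x : X}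
    (hL : ContinuousAt L x) (hM : ContinuousAt M x)
    (h : (fun y => Complex.exp (L y)) =ᶠ[𝓝 x] fun y => Complex.exp (M y)) (hx : L x = M x) :
    L =ᶠ[𝓝 x] M := by
  have him : ∀ᶠ y in 𝓝 x, (L y - M y).im ∈ Ioo (-Real.pi) Real.pi :=
    (Complex.continuous_im.continuousAt.comp (hL.sub hM)).eventually_mem
      (isOpen_Ioo.mem_nhds (by simp [hx, Real.pi_pos]))
  filter_upwards [h, him] with y hexp hy
  have hlog := Complex.log_exp hy.1 hy.2.le
  rw [Complex.exp_sub, hexp, div_self (Complex.exp_ne_zero _), Complex.log_one] at hlog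
  exact sub_eq_zero.1 hlog.symm

/-- The germs of the logarithms of the germs in the family `P`. -/
def logGerms (P : ℂ → Set (ℂ → ℂ)) (b : ℂ) : Set (ℂ → ℂ) :=
  {m | AnalyticAt ℂ m b ∧ ∃ f ∈ P b, (fun z => Complex.exp (m z)) =ᶠ[𝓝 b] f}

theorem GermsExtendOn.logGerms (hP : GermsExtendOn P (ball a r))
    (h0 : ∀ b ∈ ball a r, ∀ f ∈ P b, f b ≠ 0) : GermsExtendOn (logGerms P) (ball a r) := by
  rintro b hb m ⟨hm, f, hf, hmf⟩
  obtain ⟨F, hF, hFf, hFP⟩ := hP b hb f hf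
  obtain ⟨L, hL, hLb, hexp⟩ := exists_exp_eq_of_differentiableOn_ball hF.differentiableOn
    (fun z hz => h0 z hz F (hFP z hz)) hb (hmf.trans hFf.symm).self_of_nhds
  have hLan := hL.analyticOnNhd isOpen_ball
  have hLF : ∀ c ∈ ball a r, (fun z => Complex.exp (L z)) =ᶠ[𝓝 c] F := fun c hc =>
    eventually_of_mem (isOpen_ball.mem_nhds hc) hexp
  exact ⟨L, hLan, eventuallyEq_of_exp_eventuallyEq (hLan b hb).continuousAt hm.continuousAt
      ((hLF b hb).trans (hFf.trans hmf.symm)) hLb,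
    fun c hc => ⟨hLan c hc, F, hFP c hc, hLF c hc⟩⟩

theorem GermsExtendOn.image_comp (hP : GermsExtendOn P B) {φ : ℂ → ℂ} (hφ : Differentiable ℂ φ) :
    GermsExtendOn (fun b => (φ ∘ ·) '' P b) B := by
  rintro b hb _ ⟨f, hf, rfl⟩
  obtain ⟨F, hF, hFf, hFP⟩ := hP b hb f hf
  exact ⟨φ ∘ F, fun z hz => (hφ.analyticAt _).comp (hF z hz), hFf.fun_comp φ,
    fun c hc => mem_image_of_mem _ (hFP c hc)⟩

theorem GermsExtendOn.span (hP : GermsExtendOn P B) :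
    GermsExtendOn (fun b => (Submodule.span ℂ (P b) : Set (ℂ → ℂ))) B := by
  intro b hb f hf
  induction hf using Submodule.span_induction with
  | mem f hf =>
    obtain ⟨F, hF, hFf, hFP⟩ := hP b hb f hf
    exact ⟨F, hF, hFf, fun c hc => Submodule.subset_span (hFP c hc)⟩
  | zero => exact ⟨0, analyticOnNhd_const, .rfl, fun c _ => Submodule.zero_mem _⟩
  | add f₁ f₂ _ _ ih₁ ih₂ =>
    obtain ⟨F₁, hF₁, hFf₁, hFP₁⟩ := ih₁
    obtain ⟨F₂, hF₂, hFf₂, hFP₂⟩ := ih₂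
    exact ⟨F₁ + F₂, hF₁.add hF₂, hFf₁.add hFf₂,
      fun c hc => Submodule.add_mem _ (hFP₁ c hc) (hFP₂ c hc)⟩
  | smul k f _ ih =>
    obtain ⟨F, hF, hFf, hFP⟩ := ih
    exact ⟨k • F, fun z hz => (hF z hz).const_smul, hFf.const_smul k,
      fun c hc => Submodule.smul_mem _ _ (hFP c hc)⟩

/-- The germs at `b` of the functions `F i + h` with `b ∈ U i` and `h ∈ Q b`. It is a torsor under
`Q` when the functions `F i` differ by elements of `Q` on the overlaps of the sets `U i`. -/
def translateGerms {ι : Type*} (U : ι → Set ℂ) (F : ι → ℂ → ℂ) (Q : ℂ → Submodule ℂ (ℂ → ℂ))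
    (b : ℂ) : Set (ℂ → ℂ) :=
  {f | ∃ i, b ∈ U i ∧ ∃ h ∈ Q b, f =ᶠ[𝓝 b] F i + h}

theorem GermsExtendLocally.translateGerms {ι : Type*} {U : ι → Set ℂ} {F : ι → ℂ → ℂ}
    {Q : ℂ → Submodule ℂ (ℂ → ℂ)} (hQ : GermsExtendLocally (fun b => Q b) X)
    (hU : ∀ i, IsOpen (U i)) (hXU : X ⊆ ⋃ i, U i) (hF : ∀ i, AnalyticOnNhd ℂ (F i) (U i))
    (hdiff : ∀ i j, ∀ b ∈ U i ∩ U j, ∃ h ∈ Q b, F i =ᶠ[𝓝 b] F j + h) :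
    GermsExtendLocally (translateGerms U F Q) X := by
  intro a ha
  obtain ⟨i, hai⟩ := mem_iUnion.1 (hXU ha)
  obtain ⟨r₁, hr₁, hball⟩ := Metric.isOpen_iff.1 (hU i) a hai
  obtain ⟨r₂, hr₂, hext⟩ := hQ a ha
  refine ⟨min r₁ r₂, lt_min hr₁ hr₂, ?_⟩
  have hsub : ball a (min r₁ r₂) ⊆ U i := (ball_subset_ball (min_le_left _ _)).trans hball
  rintro b hb f ⟨j, hbj, h, hh, hf⟩
  obtain ⟨k, hk, hjk⟩ := hdiff j i b ⟨hbj, hsub hb⟩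
  obtain ⟨G, hG, hGkh, hGQ⟩ :=
    hext.mono (ball_subset_ball (min_le_right _ _)) b hb (k + h) (add_mem hk hh)
  refine ⟨F i + G, ((hF i).mono hsub).add hG, ?_, fun c hc => ⟨i, hsub hc, G, hGQ c hc, .rfl⟩⟩
  filter_upwards [hf, hjk, hGkh] with z hfz hjkz hGz
  simp only [Pi.add_apply] at hfz hjkz hGz ⊢
  rw [hfz, hjkz, hGz]
  ring

end Extension

section Monodromy

variable {P : ℂ → Set (ℂ → ℂ)} {X K : Set ℂ} {a b : ℂ} {γ δ : Path a b} {f f' : ℂ → ℂ}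

/-- The property that the germ of `f` at the source of `γ` continues along `γ`, through germs of the
family `P`, to the germ of `f'` at the target. -/
def ContinuesAlong (P : ℂ → Set (ℂ → ℂ)) (γ : Path a b) (f f' : ℂ → ℂ) : Prop :=
  ∃ g, IsAnalyticContinuationAlong γ g ∧ (∀ t, g t ∈ P (γ t)) ∧ g 0 =ᶠ[𝓝 a] f ∧ g 1 =ᶠ[𝓝 b] f'

theorem GermsExtendLocally.exists_pos_forall_ball (hP : GermsExtendLocally P X) (hK : IsCompact K)
    (hKX : K ⊆ X) : ∃ ρ > 0, ∀ c ∈ K, GermsExtendOn P (ball c ρ) := by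
  choose! r hr hext using hP
  obtain ⟨ρ, hρ, hball⟩ := lebesgue_number_lemma_of_metric (c := fun x : X => ball x.1 (r x)) hK
    (fun _ => isOpen_ball)
    (fun x hx => mem_iUnion.2 ⟨⟨x, hKX hx⟩, mem_ball_self (hr x (hKX hx))⟩)
  exact ⟨ρ, hρ, fun c hc => let ⟨x, hx⟩ := hball c hc; (hext x x.2).mono hx⟩

theorem IsAnalyticContinuationAlong.of_dist_lt {g G : I → ℂ → ℂ} {ρ : ℝ}
    (hg : IsAnalyticContinuationAlong γ g) (hG : ∀ t, AnalyticOnNhd ℂ (G t) (ball (γ t) ρ))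
    (hGg : ∀ t, G t =ᶠ[𝓝 (γ t)] g t) (hδ : ∀ t, dist (δ t) (γ t) < ρ) :
    IsAnalyticContinuationAlong δ G := by
  refine ⟨fun t => hG t _ (hδ t), fun t => ?_⟩
  have hρ : 0 < ρ := dist_nonneg.trans_lt (hδ t)
  filter_upwards [γ.continuous.continuousAt.eventually_mem (ball_mem_nhds (γ t) hρ),
    δ.continuous.continuousAt.eventually_mem (isOpen_ball.mem_nhds (hδ t)),
    γ.continuous.continuousAt.eventually (hGg t).eventually_nhds, hg.2 t] with t' hγt' hδt' hGgt hgt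
  have hGG : G t' =ᶠ[𝓝 (γ t')] G t := (hGg t').trans (hgt.trans (EventuallyEq.symm hGgt))
  have hpre : IsPreconnected (ball (γ t) ρ ∩ ball (γ t') ρ) :=
    ((convex_ball _ _).inter (convex_ball _ _)).isPreconnected
  exact (((hG t').mono inter_subset_right).eqOn_of_preconnected_of_eventuallyEq
    ((hG t).mono inter_subset_left) hpre ⟨hγt', mem_ball_self hρ⟩ hGG).eventuallyEq_of_mem
    ((isOpen_ball.inter isOpen_ball).mem_nhds ⟨hδt', hδ t'⟩)

theorem ContinuesAlong.of_dist_lt {ρ : ℝ} (hρ : 0 < ρ)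
    (hext : ∀ t, GermsExtendOn P (ball (γ t) ρ)) (hδ : ∀ t, dist (δ t) (γ t) < ρ)
    (h : ContinuesAlong P γ f f') : ContinuesAlong P δ f f' := by
  obtain ⟨g, hg, hgP, hg0, hg1⟩ := h
  choose G hG hGg hGP using fun t => hext t (γ t) (mem_ball_self hρ) (g t) (hgP t)
  refine ⟨G, hg.of_dist_lt hG hGg hδ, fun t => hGP t _ (hδ t), ?_, ?_⟩
  · simpa only [γ.source] using (hGg 0).trans (γ.source.symm ▸ hg0)
  · simpa only [γ.target] using (hGg 1).trans (γ.target.symm ▸ hg1)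

theorem GermsExtendLocally.continuesAlong_of_homotopy (hP : GermsExtendLocally P X)
    (H : γ.Homotopy δ) (hH : ∀ p, H p ∈ X) (h : ContinuesAlong P δ f f') :
    ContinuesAlong P γ f f' := by
  obtain ⟨ρ, hρ, hext⟩ :=
    hP.exists_pos_forall_ball (isCompact_range H.continuous) (range_subset_iff.2 hH)
  obtain ⟨η, hη, hunif⟩ := Metric.uniformContinuous_iff.1
    (CompactSpace.uniformContinuous_of_continuous H.continuous) ρ hρ
  have hnear : ∀ u v, dist u v < η →
      ContinuesAlong P (H.eval u) f f' → ContinuesAlong P (H.eval v) f f' := fun u v huv =>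
    .of_dist_lt hρ (fun t => hext _ (mem_range_self (u, t)))
      fun t => hunif (by simpa [Prod.dist_eq, dist_comm v u, hη] using huv)
  have hconst : IsLocallyConstant fun u => ContinuesAlong P (H.eval u) f f' :=
    (IsLocallyConstant.iff_eventually_eq _).2 fun u => by
      filter_upwards [ball_mem_nhds u hη] with v hv
      exact propext ⟨hnear v u hv, hnear u v (by rwa [dist_comm])⟩
  simpa [h] using hconst.apply_eq_of_preconnectedSpace 0 1

theorem eventually_eventuallyEq_iff {f f' : ℂ → ℂ} {z : ℂ} (hf : AnalyticAt ℂ f z)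
    (hf' : AnalyticAt ℂ f' z) : ∀ᶠ w in 𝓝 z, (f =ᶠ[𝓝 w] f' ↔ f =ᶠ[𝓝 z] f') := by
  rcases hf.eventually_eq_or_eventually_ne hf' with heq | hne
  · filter_upwards [heq.eventually_nhds] with w hw
    exact iff_of_true hw heq
  · filter_upwards [eventually_nhdsWithin_iff.1 hne |>.eventually_nhds] with w hw
    refine ⟨fun h => ?_, fun h => ?_⟩
    · obtain rfl : w = z := by_contra fun hwz => hw.self_of_nhds hwz h.self_of_nhds
      exact h
    · obtain ⟨y, hy, hy'⟩ := (hne.and (h.filter_mono nhdsWithin_le_nhds)).exists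
      exact absurd hy' hy

theorem IsAnalyticContinuationAlong.eventuallyEq {g g' : I → ℂ → ℂ}
    (hg : IsAnalyticContinuationAlong γ g) (hg' : IsAnalyticContinuationAlong γ g')
    (h0 : g 0 =ᶠ[𝓝 a] g' 0) (t : I) : g t =ᶠ[𝓝 (γ t)] g' t := by
  have hconst : IsLocallyConstant fun t => g t =ᶠ[𝓝 (γ t)] g' t :=
    (IsLocallyConstant.iff_eventually_eq _).2 fun t => by
      filter_upwards [hg.2 t, hg'.2 t, γ.continuous.continuousAt.eventually
        (eventually_eventuallyEq_iff (hg.1 t) (hg'.1 t))] with u hu hu' hiff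
      exact propext (Iff.trans ⟨fun h => hu.symm.trans (h.trans hu'),
        fun h => hu.trans (h.trans hu'.symm)⟩ hiff)
  simpa [h0] using hconst.apply_eq_of_preconnectedSpace t 0

theorem ContinuesAlong.eventuallyEq (h : ContinuesAlong P γ f f') {g : I → ℂ → ℂ}
    (hg : IsAnalyticContinuationAlong γ g) (h0 : g 0 =ᶠ[𝓝 a] f) : g 1 =ᶠ[𝓝 b] f' := by
  obtain ⟨g', hg', -, hg'0, hg'1⟩ := h
  have h1 := hg.eventuallyEq hg' (h0.trans hg'0.symm) 1
  rw [γ.target] at h1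
  exact h1.trans hg'1

theorem continuesAlong_of_isClosed_cover {ι : Type*} [Finite ι] [LinearOrder ι]
    {S : ι → Set I} (hP : GermsExtendLocally P X) (hγ : ∀ t, γ t ∈ X) (hS : ∀ j, IsClosed (S j))
    (hcover : ⋃ j, S j = univ) {F : ι → ℂ → ℂ} (hFP : ∀ j, ∀ t ∈ S j, F j ∈ P (γ t))
    (hFF : ∀ j k, j < k → ∀ t ∈ S j ∩ S k, F j =ᶠ[𝓝 (γ t)] F k) {j k : ι} (h0 : 0 ∈ S j)
    (h1 : 1 ∈ S k) : ContinuesAlong P γ (F j) (F k) := by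
  choose i hi using iUnion_eq_univ_iff.1 hcover
  have hcompat : ∀ j t, t ∈ S j → F j =ᶠ[𝓝 (γ t)] F (i t) := fun j t htj => by
    rcases lt_trichotomy j (i t) with h | h | h
    · exact hFF j (i t) h t ⟨htj, hi t⟩
    · exact h ▸ .rfl
    · exact (hFF (i t) j h t ⟨hi t, htj⟩).symm
  refine ⟨fun t => F (i t), ⟨fun t => hP.analyticAt (hγ t) (hFP _ t (hi t)), fun t => ?_⟩,
    fun t => hFP _ t (hi t), by simpa using (hcompat j 0 h0).symm,
    by simpa using (hcompat k 1 h1).symm⟩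
  have hmem : ∀ᶠ u in 𝓝 t, ∀ j, u ∈ S j → t ∈ S j := eventually_all.2 fun j => by
    by_cases htj : t ∈ S j
    · exact .of_forall fun _ _ => htj
    · exact ((hS j).isOpen_compl.eventually_mem htj).mono fun _ hu hu' => absurd hu' hu
  have hnear : ∀ᶠ u in 𝓝 t, ∀ j, t ∈ S j → F j =ᶠ[𝓝 (γ u)] F (i t) :=
    eventually_all.2 fun j => eventually_imp_distrib_left.2 fun htj =>
      γ.continuous.continuousAt.eventually (hcompat j t htj).eventually_nhds
  filter_upwards [hmem, hnear] with u hu hu'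
  exact hu' _ (hu _ (hi u))

end Monodromy

section StandardLoop

variable {w z : ℂ} {ε : ℝ} {t : I}

/-- The plane slit along the ray `[1, ∞)`. -/
def rightSlitPlane : Set ℂ := {z | 1 - z ∈ Complex.slitPlane}

/-- The plane slit along the ray `(-∞, 1]`. -/
def leftSlitPlane : Set ℂ := {z | z - 1 ∈ Complex.slitPlane}

/-- The plane slit along both rays `(-∞, 0]` and `[1, ∞)`. -/
def doublySlitPlane : Set ℂ := rightSlitPlane ∩ Complex.slitPlane

theorem mem_rightSlitPlane_iff : z ∈ rightSlitPlane ↔ z.re < 1 ∨ z.im ≠ 0 := by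
  simp [rightSlitPlane, Complex.mem_slitPlane_iff]

theorem mem_leftSlitPlane_iff : z ∈ leftSlitPlane ↔ 1 < z.re ∨ z.im ≠ 0 := by
  simp [leftSlitPlane, Complex.mem_slitPlane_iff]

theorem isOpen_rightSlitPlane : IsOpen rightSlitPlane :=
  Complex.isOpen_slitPlane.preimage (by fun_prop)

theorem isOpen_leftSlitPlane : IsOpen leftSlitPlane :=
  Complex.isOpen_slitPlane.preimage (by fun_prop)

theorem isOpen_doublySlitPlane : IsOpen doublySlitPlane :=
  isOpen_rightSlitPlane.inter Complex.isOpen_slitPlane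

theorem ball_subset_rightSlitPlane : ball 0 1 ⊆ rightSlitPlane := fun z hz =>
  mem_rightSlitPlane_iff.2 (.inl ((Complex.re_le_norm z).trans_lt (mem_ball_zero_iff.1 hz)))

theorem doublySlitPlane_subset : doublySlitPlane ⊆ {0, 1}ᶜ := by
  rintro z ⟨hz, hz'⟩ (rfl | rfl)
  · exact Complex.zero_notMem_slitPlane hz'
  · simp [mem_rightSlitPlane_iff] at hz

theorem leftSlitPlane_subset : leftSlitPlane ⊆ {0, 1}ᶜ := by
  rintro z hz (rfl | rfl) <;> norm_num [mem_leftSlitPlane_iff] at hz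

theorem mem_rightSlitPlane_or_mem_leftSlitPlane (hz : z ≠ 1) :
    z ∈ rightSlitPlane ∨ z ∈ leftSlitPlane := by
  rw [mem_rightSlitPlane_iff, mem_leftSlitPlane_iff]
  by_contra! h
  exact hz (Complex.ext (le_antisymm h.2.1 h.1.1) h.1.2)

theorem mem_slitPlane_of_re_nonneg (hz : 0 ≤ z.re) (hz0 : z ≠ 0) : z ∈ Complex.slitPlane :=
  Complex.mem_slitPlane_iff.2 (hz.lt_or_eq.imp_right fun hre him => hz0 (Complex.ext hre.symm him))

theorem mem_leftSlitPlane_of_one_le_re (hz : 1 ≤ z.re) (hz1 : z ≠ 1) : z ∈ leftSlitPlane :=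
  mem_slitPlane_of_re_nonneg (by simpa using hz) (sub_ne_zero.2 hz1)

theorem mem_doublySlitPlane_of_re_mem_Ioc (hz : z.re ∈ Ioc 0 1) (hz1 : z ≠ 1) :
    z ∈ doublySlitPlane :=
  ⟨mem_slitPlane_of_re_nonneg (by simpa using hz.2) (sub_ne_zero.2 hz1.symm),
    Complex.mem_slitPlane_iff.2 (.inl hz.1)⟩

theorem starConvex_doublySlitPlane (hε : ε ∈ Ioo (0 : ℝ) 1) :
    StarConvex ℝ (1 - ε : ℂ) doublySlitPlane := by
  have hright : StarConvex ℝ (1 - ε : ℂ) rightSlitPlane := by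
    refine StarConvex.affine_preimage
      ((AffineMap.const ℝ ℂ (1 : ℂ) - AffineMap.id ℝ ℂ : ℂ →ᵃ[ℝ] ℂ)) ?_
    simpa using Complex.starConvex_ofReal_slitPlane hε.1
  refine hright.inter ?_
  exact_mod_cast Complex.starConvex_ofReal_slitPlane (sub_pos.2 hε.2)

/-- The angle, seen from `1`, at which `standardLoop` stands at the time `t ∈ [1 / 4, 1 / 2]`, when
it runs through the circle. It is measured from the direction of `0`. -/
noncomputable def loopAngle (t : ℝ) : ℝ := 2 * Real.pi * (4 * t - 1)

theorem standardLoop_mem_segment_of_le (ht : (t : ℝ) ≤ 1 / 4) :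
    standardLoop w ε t ∈ segment ℝ (1 - ε : ℂ) w := by
  have h2 : (t : ℝ) ≤ 1 / 2 := by linarith
  have h3 : 2 * (t : ℝ) ≤ 1 / 2 := by linarith
  rw [segment_symm, ← Path.range_segment]
  simp only [standardLoop, Path.trans_apply, h2, h3, dif_pos, mem_range_self]

theorem standardLoop_mem_segment_of_ge (ht : (1 / 2 : ℝ) ≤ t) :
    standardLoop w ε t ∈ segment ℝ (1 - ε : ℂ) w := by
  rcases ht.eq_or_lt with h | h
  · simp [standardLoop, Path.trans_apply, ← h, left_mem_segment]
  · rw [← Path.range_segment]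
    simp only [standardLoop, Path.trans_apply, h.not_ge, dif_neg, not_false_iff, mem_range_self]

theorem standardLoop_apply_of_mem_Icc (ht : (t : ℝ) ∈ Icc (1 / 4 : ℝ) (1 / 2)) :
    standardLoop w ε t = 1 - ε * Complex.exp (loopAngle t * Complex.I) := by
  rcases ht.1.eq_or_lt with h | h
  · have h4 : 2 * (4 : ℝ)⁻¹ ≤ 2⁻¹ := by norm_num
    have h5 : (4 : ℝ)⁻¹ ≤ 2⁻¹ := by norm_num
    have h6 : 2 * (2 * (4 : ℝ)⁻¹) = 1 := by norm_num
    simp [standardLoop, Path.trans_apply, ← h, loopAngle, h4, h5, h6]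
  · have h2 : ¬ 2 * (t : ℝ) ≤ 1 / 2 := by linarith
    simp only [standardLoop, Path.trans_apply, ht.2, h2, dif_pos, dif_neg, not_false_iff,
      circleAboutOne, Path.coe_mk_mk, loopAngle]
    push_cast
    ring_nf

theorem standardLoop_re_of_mem_Icc (ht : (t : ℝ) ∈ Icc (1 / 4 : ℝ) (1 / 2)) :
    (standardLoop w ε t).re = 1 - ε * Real.cos (loopAngle t) := by
  simp [standardLoop_apply_of_mem_Icc ht, Complex.exp_ofReal_mul_I_re]

theorem standardLoop_im_of_mem_Icc (ht : (t : ℝ) ∈ Icc (1 / 4 : ℝ) (1 / 2)) :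
    (standardLoop w ε t).im = -(ε * Real.sin (loopAngle t)) := by
  simp [standardLoop_apply_of_mem_Icc ht, Complex.exp_ofReal_mul_I_im]

theorem standardLoop_mem_doublySlitPlane_of_cos_nonneg (hε : ε ∈ Ioo (0 : ℝ) 1)
    (ht : (t : ℝ) ∈ Icc (1 / 4 : ℝ) (1 / 2)) (hcos : 0 ≤ Real.cos (loopAngle t)) :
    standardLoop w ε t ∈ doublySlitPlane := by
  refine mem_doublySlitPlane_of_re_mem_Ioc ?_ ?_
  · rw [standardLoop_re_of_mem_Icc ht]
    have hmul := mul_nonneg hε.1.le hcos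
    have hle := mul_le_mul_of_nonneg_left (Real.cos_le_one (loopAngle t)) hε.1.le
    exact ⟨by linarith [hε.2], by linarith⟩
  · simp [standardLoop_apply_of_mem_Icc ht, hε.1.ne']

theorem standardLoop_mem_doublySlitPlane (hw : w ∈ doublySlitPlane) (hε : ε ∈ Ioo (0 : ℝ) 1)
    (ht : (t : ℝ) ∉ Ioo (5 / 16 : ℝ) (7 / 16)) : standardLoop w ε t ∈ doublySlitPlane := by
  have hseg := (starConvex_iff_segment_subset.1 (starConvex_doublySlitPlane hε)) hw
  have hpi := Real.pi_pos
  rcases le_or_gt (t : ℝ) (1 / 4) with h | h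
  · exact hseg (standardLoop_mem_segment_of_le h)
  rcases le_or_gt (1 / 2 : ℝ) t with h' | h'
  · exact hseg (standardLoop_mem_segment_of_ge h')
  refine standardLoop_mem_doublySlitPlane_of_cos_nonneg hε ⟨h.le, h'.le⟩ ?_
  rcases le_or_gt (t : ℝ) (5 / 16) with h'' | h''
  · exact Real.cos_nonneg_of_mem_Icc
      ⟨by unfold loopAngle; nlinarith, by unfold loopAngle; nlinarith⟩
  · have := not_lt.1 fun h => ht ⟨h'', h⟩
    rw [← Real.cos_sub_two_pi]
    exact Real.cos_nonneg_of_mem_Icc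
      ⟨by unfold loopAngle; nlinarith, by unfold loopAngle; nlinarith⟩

theorem standardLoop_mem_leftSlitPlane (hε : ε ∈ Ioo (0 : ℝ) 1)
    (ht : (t : ℝ) ∈ Icc (5 / 16 : ℝ) (7 / 16)) : standardLoop w ε t ∈ leftSlitPlane := by
  have ht' : (t : ℝ) ∈ Icc (1 / 4 : ℝ) (1 / 2) := ⟨by linarith [ht.1], by linarith [ht.2]⟩
  refine mem_leftSlitPlane_of_one_le_re ?_ ?_
  · have hpi := Real.pi_pos
    have hcos : Real.cos (loopAngle t) ≤ 0 := Real.cos_nonpos_of_pi_div_two_le_of_le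
      (by unfold loopAngle; nlinarith [ht.1]) (by unfold loopAngle; nlinarith [ht.2])
    rw [standardLoop_re_of_mem_Icc ht']
    linarith [mul_nonpos_of_nonneg_of_nonpos hε.1.le hcos]
  · simp [standardLoop_apply_of_mem_Icc ht', hε.1.ne']

theorem standardLoop_mem_compl (hw : w ∈ doublySlitPlane) (hε : ε ∈ Ioo (0 : ℝ) 1) (t : I) :
    standardLoop w ε t ∈ ({0, 1}ᶜ : Set ℂ) := by
  by_cases ht : (t : ℝ) ∈ Ioo (5 / 16 : ℝ) (7 / 16)
  · exact leftSlitPlane_subset (standardLoop_mem_leftSlitPlane hε (Ioo_subset_Icc_self ht))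
  · exact doublySlitPlane_subset (standardLoop_mem_doublySlitPlane hw hε ht)

theorem standardLoop_im_neg (hε : 0 < ε) (ht : (t : ℝ) = 5 / 16) : (standardLoop w ε t).im < 0 := by
  have hangle : loopAngle t = Real.pi / 2 := by rw [loopAngle, ht]; ring
  rw [standardLoop_im_of_mem_Icc (by norm_num [ht]), hangle, Real.sin_pi_div_two]
  linarith

theorem standardLoop_im_pos (hε : 0 < ε) (ht : (t : ℝ) = 7 / 16) : 0 < (standardLoop w ε t).im := by
  have hangle : loopAngle t = Real.pi / 2 + Real.pi := by rw [loopAngle, ht]; ring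
  rw [standardLoop_im_of_mem_Icc (by norm_num [ht]), hangle, Real.sin_add_pi, Real.sin_pi_div_two]
  linarith

/-- Three closed arcs covering the parameters of `standardLoop`, which stays in `leftSlitPlane`
during the middle one and in `doublySlitPlane` during the two others. -/
def loopArcs : Fin 3 → Set I :=
  ![{t | (t : ℝ) ≤ 5 / 16}, {t | (t : ℝ) ∈ Icc (5 / 16 : ℝ) (7 / 16)}, {t | (7 / 16 : ℝ) ≤ t}]

theorem isClosed_loopArcs (i : Fin 3) : IsClosed (loopArcs i) := by
  fin_cases i
  · exact isClosed_le continuous_subtype_val continuous_const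
  · exact isClosed_Icc.preimage continuous_subtype_val
  · exact isClosed_le continuous_const continuous_subtype_val

theorem iUnion_loopArcs : ⋃ i, loopArcs i = univ := by
  refine iUnion_eq_univ_iff.2 fun t => ?_
  rcases le_or_gt (t : ℝ) (5 / 16) with h | h
  · exact ⟨0, h⟩
  rcases le_or_gt (t : ℝ) (7 / 16) with h' | h'
  · exact ⟨1, h.le, h'⟩
  · exact ⟨2, h'.le⟩

variable {P : ℂ → Set (ℂ → ℂ)} {F : Fin 3 → ℂ → ℂ}

theorem continuesAlong_standardLoop (hP : GermsExtendLocally P {0, 1}ᶜ) (hw : w ∈ doublySlitPlane)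
    (hε : ε ∈ Ioo (0 : ℝ) 1) (h0 : ∀ z ∈ doublySlitPlane, F 0 ∈ P z)
    (h1 : ∀ z ∈ leftSlitPlane, F 1 ∈ P z) (h2 : ∀ z ∈ doublySlitPlane, F 2 ∈ P z)
    (h01 : ∀ z : ℂ, z.im < 0 → F 0 z = F 1 z) (h12 : ∀ z : ℂ, 0 < z.im → F 1 z = F 2 z) :
    ContinuesAlong P (standardLoop w ε) (F 0) (F 2) := by
  have hmem : ∀ j, ∀ t ∈ loopArcs j, F j ∈ P (standardLoop w ε t) := by
    intro j t ht
    fin_cases j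
    · exact h0 _ (standardLoop_mem_doublySlitPlane hw hε fun h => ht.not_gt h.1)
    · exact h1 _ (standardLoop_mem_leftSlitPlane hε ht)
    · exact h2 _ (standardLoop_mem_doublySlitPlane hw hε fun h => ht.not_gt h.2)
  refine continuesAlong_of_isClosed_cover hP (standardLoop_mem_compl hw hε) isClosed_loopArcs
    iUnion_loopArcs hmem ?_ (by norm_num [loopArcs]) (show (7 / 16 : ℝ) ≤ 1 by norm_num)
  rintro j k hjk t ⟨htj, htk⟩
  fin_cases j <;> fin_cases k <;> simp at hjk
  · exact eventually_of_mem ((isOpen_Iio.preimage Complex.continuous_im).mem_nhds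
      (standardLoop_im_neg hε.1 (le_antisymm htj htk.1))) h01
  · norm_num [loopArcs] at htj htk
    linarith
  · exact eventually_of_mem ((isOpen_Ioi.preimage Complex.continuous_im).mem_nhds
      (standardLoop_im_pos hε.1 (le_antisymm htj.2 htk))) h12

theorem IsLoopAboutOne.continuesAlong {γ : Path w w} (hγ : IsLoopAboutOne γ)
    (hP : GermsExtendLocally P {0, 1}ᶜ) (hw : w ∈ doublySlitPlane)
    (h0 : ∀ z ∈ doublySlitPlane, F 0 ∈ P z)
    (h1 : ∀ z ∈ leftSlitPlane, F 1 ∈ P z) (h2 : ∀ z ∈ doublySlitPlane, F 2 ∈ P z)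
    (h01 : ∀ z : ℂ, z.im < 0 → F 0 z = F 1 z) (h12 : ∀ z : ℂ, 0 < z.im → F 1 z = F 2 z) :
    ContinuesAlong P γ (F 0) (F 2) := by
  obtain ⟨ε, hε, H, hH⟩ := hγ
  exact hP.continuesAlong_of_homotopy H (fun p => by simpa using hH p)
    (continuesAlong_standardLoop hP hw hε h0 h1 h2 h01 h12)

end StandardLoop

section CurveIntegral

variable {a b w : ℂ} {γ : Path a b} {ω : ℂ → ℂ →L[ℂ] ℂ} {f f' : ℂ → ℂ}

theorem IsPiecewiseC1.curveIntegrable (hγ : IsPiecewiseC1 γ) {S : Set ℂ} (hω : ContinuousOn ω S)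
    (hS : ∀ t, γ t ∈ S) : CurveIntegrable ω γ := by
  obtain ⟨n, τ, hτ, h0, h1, hC⟩ := hγ
  suffices h : IntervalIntegrable (curveIntegralFun ω γ) volume (τ 0) (τ n) by rwa [h0, h1] at h
  refine IntervalIntegrable.trans_iterate fun i hi => ?_
  have hle := hτ i.lt_succ_self
  have hsub : Icc (τ i) (τ (i + 1)) ⊆ Icc 0 1 := by
    rw [← h0, ← h1]
    exact Icc_subset_Icc (hτ.monotone i.zero_le) (hτ.monotone hi)
  have hcont : ContinuousOn (fun t => ω (γ.extend t)
      (derivWithin γ.extend (Icc (τ i) (τ (i + 1))) t)) (Icc (τ i) (τ (i + 1))) :=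
    (hω.comp γ.continuous_extend.continuousOn fun t ht => by
      simpa only [Path.extend_apply γ (hsub ht)] using hS _).clm_apply
      ((hC i hi).continuousOn_derivWithin (uniqueDiffOn_Icc hle) le_rfl)
  refine (hcont.intervalIntegrable_of_Icc hle.le).congr_ae ?_
  rw [uIoc_of_le hle.le, ← restrict_Ioo_eq_restrict_Ioc]
  filter_upwards [ae_restrict_mem measurableSet_Ioo] with t ht
  have hmem : Icc (τ i) (τ (i + 1)) ∈ 𝓝 t := Icc_mem_nhds ht.1 ht.2
  rw [curveIntegralFun_def, derivWithin_of_mem_nhds hmem,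
    derivWithin_of_mem_nhds (mem_of_superset hmem hsub)]

theorem IsPiecewiseC1.exists_countable_hasDerivAt (hγ : IsPiecewiseC1 γ) :
    ∃ S : Set ℝ, S.Countable ∧ ∀ t ∈ Ioo (0 : ℝ) 1 \ S,
      HasDerivAt γ.extend (derivWithin γ.extend (Icc 0 1) t) t := by
  obtain ⟨n, τ, hτ, h0, h1, hC⟩ := hγ
  refine ⟨range τ, countable_range τ, fun t ⟨ht, htτ⟩ => ?_⟩
  obtain ⟨i, hi, hit⟩ : ∃ i < n, t ∈ Ioc (τ i) (τ (i + 1)) := by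
    simpa [and_left_comm] using (hτ.monotone.biUnion_Ico_Ioc_map_succ 0 n).symm.subset
      (by rw [h0, h1]; exact ⟨ht.1, ht.2.le⟩)
  have hlt : t < τ (i + 1) := hit.2.lt_of_ne fun h => htτ ⟨_, h.symm⟩
  have hd := ((hC i hi).differentiableOn one_ne_zero t ⟨hit.1.le, hit.2⟩).differentiableAt
    (Icc_mem_nhds hit.1 hlt)
  simpa only [derivWithin_of_mem_nhds (Icc_mem_nhds ht.1 ht.2)] using hd.hasDerivAt

theorem ContinuesAlong.curveIntegral_eq_sub (h : ContinuesAlong (primitiveGerms ω) γ f f')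
    (hγ : IsPiecewiseC1 γ) (hint : CurveIntegrable ω γ) :
    curveIntegral ω γ = f' b - f a := by
  obtain ⟨g, hg, hgω, hg0, hg1⟩ := h
  obtain ⟨S, hS, hγd⟩ := hγ.exists_countable_hasDerivAt
  set p : ℝ → I := projIcc 0 1 zero_le_one
  set ℓ : ℝ → ℂ := fun t => g (p t) (γ.extend t)
  have hloc : ∀ t, (fun u => g (p t) (γ.extend u)) =ᶠ[𝓝 t] ℓ := fun t =>
    (continuous_projIcc.continuousAt.eventually (hg.2 (p t))).mono
      fun u hu => hu.self_of_nhds.symm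
  have hcont : Continuous ℓ := continuous_iff_continuousAt.2 fun t =>
    (ContinuousAt.comp (f := γ.extend) (hg.1 (p t)).continuousAt
      γ.continuous_extend.continuousAt).congr (hloc t)
  have hderiv : ∀ t ∈ Ioo (0 : ℝ) 1 \ S, HasDerivAt ℓ (curveIntegralFun ω γ t) t := fun t ht => by
    have hgt : HasFDerivAt (g (p t)) (ω (γ.extend t)) (γ.extend t) := (hgω (p t)).self_of_nhds
    rw [curveIntegralFun_def]
    exact ((hgt.restrictScalars ℝ).comp_hasDerivAt t (hγd t ht)).congr_of_eventuallyEq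
      (hloc t).symm
  rw [curveIntegral_def, integral_eq_of_hasDerivAt_off_countable_of_le ℓ _ zero_le_one hS
    hcont.continuousOn hderiv hint]
  simp [ℓ, p, hg0.self_of_nhds, hg1.self_of_nhds]

theorem log_neg_of_im_pos {z : ℂ} (hz : 0 < z.im) :
    Complex.log (-z) = Complex.log z - Real.pi * Complex.I := by
  rw [Complex.log, Complex.log, norm_neg, Complex.arg_neg_eq_arg_sub_pi_of_im_pos hz]
  push_cast
  ring

theorem log_neg_of_im_neg {z : ℂ} (hz : z.im < 0) :
    Complex.log (-z) = Complex.log z + Real.pi * Complex.I := by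
  rw [Complex.log, Complex.log, norm_neg, Complex.arg_neg_eq_arg_add_pi_of_im_neg hz]
  push_cast
  ring

theorem differentiableOn_formOne : DifferentiableOn ℂ formOne {1}ᶜ := fun _ hx =>
  (((differentiableAt_id.const_sub 1).inv (sub_ne_zero.2 (Ne.symm hx))).smul_const
    _).differentiableWithinAt

theorem hasFDerivAt_formOne {z : ℂ} (hf : HasDerivAt f (1 - z)⁻¹ z) :
    HasFDerivAt f (formOne z) z := by
  have : formOne z = ContinuousLinearMap.toSpanSingleton ℂ (1 - z)⁻¹ := by ext; simp [formOne]
  exact this ▸ hf.hasFDerivAt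

theorem germsExtendLocally_primitiveGerms_formOne :
    GermsExtendLocally (primitiveGerms formOne) {0, 1}ᶜ := by
  intro a ha
  obtain ⟨r, hr, hball⟩ := Metric.isOpen_iff.1 isOpen_compl_singleton a (mt .inr ha)
  exact ⟨r, hr, germsExtendOn_primitiveGerms (differentiableOn_formOne.mono hball)⟩

theorem neg_log_one_sub_add_mem_primitiveGerms (c : ℂ) {z : ℂ} (hz : z ∈ rightSlitPlane) :
    (fun z => -Complex.log (1 - z) + c) ∈ primitiveGerms formOne z :=
  eventually_of_mem (isOpen_rightSlitPlane.mem_nhds hz) fun x hx =>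
    hasFDerivAt_formOne (by simpa [neg_div] using
      (((hasDerivAt_id x).const_sub 1).clog hx).neg.add_const c)

theorem neg_log_sub_one_add_mem_primitiveGerms (c : ℂ) {z : ℂ} (hz : z ∈ leftSlitPlane) :
    (fun z => -Complex.log (z - 1) + c) ∈ primitiveGerms formOne z :=
  eventually_of_mem (isOpen_leftSlitPlane.mem_nhds hz) fun x hx =>
    hasFDerivAt_formOne (by simpa [← inv_neg] using
      (((hasDerivAt_id x).sub_const 1).clog hx).neg.add_const c)

theorem IsLoopAboutOne.ne_one {γ : Path w w} (hγ : IsLoopAboutOne γ) (t : I) : γ t ≠ 1 := by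
  obtain ⟨_, _, H, hH⟩ := hγ
  simpa using (hH (0, t)).2

theorem IsLoopAboutOne.curveIntegrable_formOne {γ : Path w w} (hγ : IsLoopAboutOne γ)
    (hC : IsPiecewiseC1 γ) : CurveIntegrable formOne γ :=
  hC.curveIntegrable differentiableOn_formOne.continuousOn hγ.ne_one

theorem IsLoopAboutOne.curveIntegral_formOne {γ : Path w w} (hγ : IsLoopAboutOne γ)
    (hC : IsPiecewiseC1 γ) (hw : w ∈ doublySlitPlane) :
    curveIntegral formOne γ = -(2 * Real.pi * Complex.I) := by
  have hcont := hγ.continuesAlong (P := primitiveGerms formOne)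
    (F := ![fun z => -Complex.log (1 - z) + 0,
      fun z => -Complex.log (z - 1) + -(Real.pi * Complex.I),
      fun z => -Complex.log (1 - z) + -(2 * Real.pi * Complex.I)])
    germsExtendLocally_primitiveGerms_formOne hw
    (fun z hz => neg_log_one_sub_add_mem_primitiveGerms _ hz.1)
    (fun z hz => neg_log_sub_one_add_mem_primitiveGerms _ hz)
    (fun z hz => neg_log_one_sub_add_mem_primitiveGerms _ hz.1)
    (fun z hz => ?_) (fun z hz => ?_)
  · rw [hcont.curveIntegral_eq_sub hC (hγ.curveIntegrable_formOne hC)]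
    simp
  · change -Complex.log (1 - z) + 0 = -Complex.log (z - 1) + -(Real.pi * Complex.I)
    rw [← neg_sub z 1, log_neg_of_im_neg (by simpa using hz)]
    ring
  · change -Complex.log (z - 1) + -(Real.pi * Complex.I) =
      -Complex.log (1 - z) + -(2 * Real.pi * Complex.I)
    rw [← neg_sub z 1, log_neg_of_im_pos (by simpa using hz)]
    ring

end CurveIntegral

section HolomorphicIntegrals

variable {α E : Type*} [MeasurableSpace α] {μ : Measure α} [NormedAddCommGroup E] [NormedSpace ℂ E]
  {F : ℂ → α → E} {U : Set ℂ} {ψ : ℂ → ℂ} {c a z : ℂ}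

theorem aestronglyMeasurable_deriv_of_ae_differentiableAt
    (hmeas : ∀ᶠ z in 𝓝 c, AEStronglyMeasurable (F z) μ)
    (hdiff : ∀ᵐ t ∂μ, DifferentiableAt ℂ (fun z => F z t) c) :
    AEStronglyMeasurable (fun t => deriv (fun z => F z t) c) μ := by
  set S := {z | AEStronglyMeasurable (F z) μ}
  have hS : ∀ᶠ z in 𝓝 c, z ∈ S := hmeas
  refine aestronglyMeasurable_of_tendsto_ae (𝓝[≠] c)
    (f := fun z t => S.indicator (slope (fun z => F z t) c) z) (fun z => ?_) ?_
  · by_cases hz : z ∈ S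
    · simp only [indicator_of_mem hz, slope_def_module]
      exact (hz.sub hS.self_of_nhds).const_smul _
    · simpa only [indicator_of_notMem hz] using aestronglyMeasurable_const
  · filter_upwards [hdiff] with t ht
    refine (hasDerivAt_iff_tendsto_slope.1 ht.hasDerivAt).congr' ?_
    filter_upwards [mem_nhdsWithin_of_mem_nhds hS] with z hz
    rw [indicator_of_mem hz]

theorem differentiableOn_integral_of_locally_dominated (hU : IsOpen U)
    (hmeas : ∀ z ∈ U, AEStronglyMeasurable (F z) μ)
    (hdiff : ∀ᵐ t ∂μ, DifferentiableOn ℂ (fun z => F z t) U)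
    (hdom : ∀ c ∈ U, ∃ r > 0, ∃ M : α → ℝ, Integrable M μ ∧
      ∀ᵐ t ∂μ, ∀ z ∈ ball c r, ‖F z t‖ ≤ M t) :
    DifferentiableOn ℂ (fun z => ∫ t, F z t ∂μ) U := by
  intro c hc
  obtain ⟨r₁, hr₁, M, hM, hbound⟩ := hdom c hc
  obtain ⟨r₂, hr₂, hball⟩ := Metric.isOpen_iff.1 hU c hc
  set r := min r₁ r₂
  have hr0 : 0 < r := lt_min hr₁ hr₂
  have hderiv : ∀ᵐ t ∂μ, ∀ z ∈ ball c (r / 2),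
      HasDerivAt (fun z => F z t) (deriv (fun z => F z t) z) z := by
    filter_upwards [hdiff] with t ht z hz
    exact (ht.differentiableAt (hU.mem_nhds (hball (ball_subset_ball
      (by linarith [min_le_right r₁ r₂]) hz)))).hasDerivAt
  have hderiv_le : ∀ᵐ t ∂μ, ∀ z ∈ ball c (r / 2),
      ‖deriv (fun z => F z t) z‖ ≤ M t / (r / 4) := by
    filter_upwards [hbound, hdiff] with t hbt hdt z hz
    have hsub : closedBall z (r / 4) ⊆ ball c r :=
      closedBall_subset_ball' (by linarith [mem_ball.1 hz])
    refine Complex.norm_deriv_le_of_forall_mem_sphere_norm_le (by linarith)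
      ((hdt.mono ?_).diffContOnCl_ball subset_rfl) fun y hy =>
        hbt y (ball_subset_ball (min_le_left _ _) (hsub (sphere_subset_closedBall hy)))
    exact hsub.trans ((ball_subset_ball (min_le_right _ _)).trans hball)
  have hderiv_meas : AEStronglyMeasurable (fun t => deriv (fun z => F z t) c) μ :=
    aestronglyMeasurable_deriv_of_ae_differentiableAt (eventually_of_mem (hU.mem_nhds hc) hmeas)
      (hdiff.mono fun t ht => ht.differentiableAt (hU.mem_nhds hc))
  refine (hasDerivAt_integral_of_dominated_loc_of_deriv_le (ball_mem_nhds c (half_pos hr0))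
    (eventually_of_mem (hU.mem_nhds hc) hmeas) (hM.mono' (hmeas c hc) ?_) hderiv_meas hderiv_le
    (hM.div_const _) hderiv).2.differentiableAt.differentiableWithinAt
  filter_upwards [hbound] with t ht using ht c (mem_ball_self hr₁)

theorem differentiableOn_integral_mul_of_isCompact [TopologicalSpace α] [OpensMeasurableSpace α]
    [T2Space α] {K s : Set α} {φ : α → ℂ} {k : ℂ → α → ℂ} (hU : IsOpen U) (hK : IsCompact K)
    (hs : MeasurableSet s) (hsK : s ⊆ K) (hφ : IntegrableOn φ s μ)
    (hk : ContinuousOn (Function.uncurry k) (U ×ˢ K))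
    (hkd : ∀ t ∈ s, DifferentiableOn ℂ (fun z => k z t) U) :
    DifferentiableOn ℂ (fun z => ∫ t in s, φ t * k z t ∂μ) U := by
  have hkz : ∀ z ∈ U, ContinuousOn (k z) K := fun z hz =>
    hk.comp (f := fun t => (z, t)) (by fun_prop) fun _ ht => ⟨hz, ht⟩
  refine differentiableOn_integral_of_locally_dominated hU
    (fun z hz => (hφ.mul_continuousOn_of_subset (hkz z hz) hs hK hsK).1)
    ((ae_restrict_mem hs).mono fun t ht => (hkd t ht).const_mul _) fun c hc => ?_
  obtain ⟨r, hr, hball⟩ := nhds_basis_closedBall.mem_iff.1 (hU.mem_nhds hc)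
  obtain ⟨C, hC⟩ := ((isCompact_closedBall c r).prod hK).exists_bound_of_continuousOn
    (hk.mono (prod_mono_left hball))
  refine ⟨r, hr, fun t => ‖φ t‖ * C, hφ.norm.mul_const C, ?_⟩
  filter_upwards [ae_restrict_mem hs] with t ht z hz
  rw [norm_mul]
  exact mul_le_mul_of_nonneg_left (hC (z, t) ⟨ball_subset_closedBall hz, hsK ht⟩) (norm_nonneg _)

theorem norm_dslope_le {r C C' : ℝ}
    (hψ : DifferentiableOn ℂ ψ (ball c (2 * r))) (hC : ∀ x ∈ ball c (2 * r), ‖ψ x‖ ≤ C)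
    (hC' : ∀ x ∈ ball c (2 * r), ‖deriv ψ x‖ ≤ C') (hz : z ∈ ball c r) :
    ‖dslope ψ a z‖ ≤ (C + ‖ψ a‖) / r + C' := by
  have hr : 0 < r := pos_of_mem_ball hz
  have hz2 : z ∈ ball c (2 * r) := ball_subset_ball (by linarith) hz
  have hC0 : 0 ≤ C := (norm_nonneg _).trans (hC z hz2)
  have hC'0 : 0 ≤ C' := (norm_nonneg _).trans (hC' z hz2)
  by_cases ha : a ∈ ball c (2 * r)
  · refine le_add_of_nonneg_of_le (by positivity) ?_
    rcases eq_or_ne z a with rfl | hza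
    · rw [dslope_same]
      exact hC' z hz2
    · rw [dslope_of_ne _ hza, slope_def_field, norm_div,
        div_le_iff₀ (norm_pos_iff.2 (sub_ne_zero.2 hza))]
      exact (convex_ball c (2 * r)).norm_image_sub_le_of_norm_deriv_le
        (fun x hx => hψ.differentiableAt (isOpen_ball.mem_nhds hx)) hC' ha hz2
  · refine le_add_of_le_of_nonneg ?_ hC'0
    have hr_le : r ≤ ‖z - a‖ := by
      have := dist_triangle a z c
      rw [mem_ball] at ha hz
      rw [← dist_eq_norm, dist_comm]
      linarith
    have hza : z ≠ a := sub_ne_zero.1 (norm_pos_iff.1 (hr.trans_le hr_le))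
    rw [dslope_of_ne _ hza, slope_def_field, norm_div]
    gcongr
    exact (norm_sub_le _ _).trans (by gcongr; exact hC z hz2)

theorem differentiableOn_integral_dslope [IsFiniteMeasure μ] {p : α → ℂ}
    (hU : IsOpen U) (hψ : DifferentiableOn ℂ ψ U) (hp : Measurable p) (hpU : ∀ᵐ t ∂μ, p t ∈ U)
    (hint : Integrable (fun t => ψ (p t)) μ) :
    DifferentiableOn ℂ (fun z => ∫ t, dslope ψ (p t) z ∂μ) U := by
  refine differentiableOn_integral_of_locally_dominated hU (fun z _ => ?_)
    (hpU.mono fun t ht => (Complex.differentiableOn_dslope (hU.mem_nhds ht)).2 hψ) fun c hc => ?_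
  · have hite : (fun t => dslope ψ (p t) z) = {t | p t = z}.piecewise (fun _ => deriv ψ z)
        fun t => (z - p t)⁻¹ * (ψ z - ψ (p t)) := by
      ext t
      by_cases h : p t = z
      · simp [h]
      · simp [h, dslope_of_ne _ (Ne.symm h), slope_def_field, div_eq_inv_mul]
    rw [hite]
    exact aestronglyMeasurable_const.piecewise (measurableSet_eq_fun hp measurable_const)
      (((by fun_prop : Measurable fun t => (z - p t)⁻¹).aestronglyMeasurable.mul
        (aestronglyMeasurable_const.sub hint.1)).restrict)
  · obtain ⟨R, hR, hball⟩ := nhds_basis_closedBall.mem_iff.1 (hU.mem_nhds hc)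
    have hsub : ball c (2 * (R / 2)) ⊆ closedBall c R := by
      rw [mul_div_cancel₀ R two_ne_zero]
      exact ball_subset_closedBall
    obtain ⟨C, hC⟩ := (isCompact_closedBall c R).exists_bound_of_continuousOn
      (hψ.continuousOn.mono hball)
    obtain ⟨C', hC'⟩ := (isCompact_closedBall c R).exists_bound_of_continuousOn
      ((hψ.deriv hU).continuousOn.mono hball)
    exact ⟨R / 2, half_pos hR, fun t => (C + ‖ψ (p t)‖) / (R / 2) + C',
      (((integrable_const C).add hint.norm).div_const _).add (integrable_const C'),
      .of_forall fun t z hz => norm_dslope_le (hψ.mono (hsub.trans hball))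
        (fun x hx => hC x (hsub hx)) (fun x hx => hC' x (hsub hx)) hz⟩

end HolomorphicIntegrals

section Polylog

variable {s z : ℂ}

theorem image_exp_neg_Ioi : (fun x : ℝ => Real.exp (-x)) '' Ioi 0 = Ioo 0 1 := by
  ext t
  constructor
  · rintro ⟨x, hx, rfl⟩
    exact ⟨Real.exp_pos _, Real.exp_lt_one_iff.2 (neg_neg_of_pos hx)⟩
  · rintro ⟨h0, h1⟩
    exact ⟨-Real.log t, neg_pos.2 (Real.log_neg h0 h1), by simp [Real.exp_log h0]⟩

theorem hasDerivWithinAt_exp_neg (S : Set ℝ) (x : ℝ) :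
    HasDerivWithinAt (fun x : ℝ => Real.exp (-x)) (-Real.exp (-x)) S x := by
  simpa using (hasDerivAt_neg x).exp.hasDerivWithinAt

theorem injective_exp_neg : Function.Injective fun x : ℝ => Real.exp (-x) :=
  Real.exp_injective.comp neg_injective

theorem integrableOn_Ioo_zero_one_iff_exp_neg {E : Type*} [NormedAddCommGroup E] [NormedSpace ℝ E]
    (f : ℝ → E) : IntegrableOn f (Ioo 0 1) ↔
      IntegrableOn (fun x => Real.exp (-x) • f (Real.exp (-x))) (Ioi 0) := by
  rw [← image_exp_neg_Ioi, integrableOn_image_iff_integrableOn_abs_deriv_smul measurableSet_Ioi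
    (fun x _ => hasDerivWithinAt_exp_neg _ x) injective_exp_neg.injOn]
  simp only [abs_neg, Real.abs_exp]

theorem integral_Ioo_zero_one_eq_exp_neg {E : Type*} [NormedAddCommGroup E] [NormedSpace ℝ E]
    (f : ℝ → E) : ∫ t in Ioo 0 1, f t = ∫ x in Ioi 0, Real.exp (-x) • f (Real.exp (-x)) := by
  rw [← image_exp_neg_Ioi, integral_image_eq_integral_abs_deriv_smul measurableSet_Ioi
    (fun x _ => hasDerivWithinAt_exp_neg _ x) injective_exp_neg.injOn]
  simp only [abs_neg, Real.abs_exp]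

/-- The density `(-log ζ) ^ (s - 1)`, in terms of which `Li_s` is the integral
`(1 / Γ(s)) ∫_0^1 (-log t) ^ (s - 1) z / (1 - t z) dt`; principal determinations throughout. -/
noncomputable def negLogPow (s ζ : ℂ) : ℂ :=
  Complex.exp ((s - 1) * Complex.log (-Complex.log ζ))

/-- The polylogarithm on `rightSlitPlane`. -/
noncomputable def polylogRight (s z : ℂ) : ℂ :=
  1 / Complex.Gamma s * ∫ t in Ioo (0 : ℝ) 1, negLogPow s t * (z / (1 - t * z))

/-- The continuation of the polylogarithm from the upper half plane to `leftSlitPlane`. For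
`0 < im z` it is obtained from `polylogRight` by subtracting and adding `negLogPow s z⁻¹` to the
density, which removes the pole of the kernel at `t = z⁻¹`. -/
noncomputable def polylogLeft (s z : ℂ) : ℂ :=
  1 / Complex.Gamma s *
    (negLogPow s z⁻¹ * (Complex.log z⁻¹ - Complex.log (1 - z⁻¹) + Real.pi * Complex.I) -
      ∫ t in Ioo (0 : ℝ) 1, dslope (negLogPow s) t z⁻¹)

theorem neg_log_mem_slitPlane (hz : z ∈ doublySlitPlane) : -Complex.log z ∈ Complex.slitPlane := by
  rw [Complex.mem_slitPlane_iff]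
  by_contra! ⟨hre, him⟩
  simp only [Complex.neg_re, Complex.neg_im, neg_nonpos, neg_eq_zero] at hre him
  have hlog : Complex.log z = ((Complex.log z).re : ℂ) := Complex.ext (by simp) (by simp [him])
  have hexp : z = (Real.exp (Complex.log z).re : ℝ) := by
    rw [Complex.ofReal_exp, ← hlog, Complex.exp_log (Complex.slitPlane_ne_zero hz.2)]
  have hlt : Real.exp (Complex.log z).re < 1 := by
    have hmem : 1 - z ∈ Complex.slitPlane := hz.1
    rw [hexp] at hmem
    exact sub_pos.1 (Complex.ofReal_mem_slitPlane.1 (by exact_mod_cast hmem))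
  exact hlt.not_ge (Real.one_le_exp hre)

theorem analyticAt_log_neg_log (hz : z ∈ doublySlitPlane) :
    AnalyticAt ℂ (fun z => Complex.log (-Complex.log z)) z :=
  (analyticAt_id.clog hz.2).neg.clog (neg_log_mem_slitPlane hz)

theorem analyticOnNhd_negLogPow (s : ℂ) : AnalyticOnNhd ℂ (negLogPow s) doublySlitPlane :=
  fun _ hz => (analyticAt_const.mul (analyticAt_log_neg_log hz)).cexp

theorem negLogPow_exp_neg {x : ℝ} (hx : 0 < x) (s : ℂ) :
    negLogPow s (Real.exp (-x) : ℝ) = (x : ℂ) ^ (s - 1) := by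
  rw [negLogPow, ← Complex.ofReal_log (Real.exp_pos _).le, Real.log_exp, Complex.ofReal_neg,
    neg_neg, Complex.cpow_def_of_ne_zero (by exact_mod_cast hx.ne'), mul_comm]

theorem integrableOn_negLogPow (hs : 0 < s.re) :
    IntegrableOn (fun t : ℝ => negLogPow s t) (Ioo 0 1) := by
  rw [integrableOn_Ioo_zero_one_iff_exp_neg]
  refine (Complex.GammaIntegral_convergent hs).congr_fun (fun x hx => ?_) measurableSet_Ioi
  rw [negLogPow_exp_neg hx, Complex.real_smul]

theorem mellin_geometric_eq_Gamma_mul_polylog (hs : 0 < s.re) (hz : ‖z‖ < 1) :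
    mellin (fun x => z * Real.exp (-x) / (1 - z * Real.exp (-x))) s =
      Complex.Gamma s * polylog s z := by
  refine (hasSum_mellin (ι := ℕ) (a := fun n => z ^ (n + 1)) (p := fun n => (n : ℝ) + 1)
    (fun n => .inr (by positivity)) hs (fun x hx => ?_) ?_).tsum_eq.symm.trans ?_
  · have hlt : ‖z * Real.exp (-x)‖ < 1 := by
      rw [norm_mul, Complex.norm_real, Real.norm_of_nonneg (Real.exp_pos _).le]
      exact mul_lt_one_of_nonneg_of_lt_one_left (norm_nonneg _) hz
        (Real.exp_lt_one_iff.2 (neg_neg_of_pos hx)).le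
    rw [div_eq_mul_inv]
    refine ((hasSum_geometric_of_norm_lt_one hlt).mul_left _).congr_fun fun n => ?_
    rw [← pow_succ', mul_pow, ← Complex.ofReal_pow, ← Real.exp_nat_mul]
    push_cast
    ring_nf
  · refine Summable.of_nonneg_of_le (fun n => by positivity) (fun n => ?_)
      ((summable_geometric_of_lt_one (norm_nonneg z) hz).mul_left ‖z‖)
    rw [norm_pow, ← pow_succ']
    exact div_le_self (by positivity)
      (Real.one_le_rpow (by linarith [n.cast_nonneg (α := ℝ)]) hs.le)
  · rw [polylog, ← tsum_mul_left]
    refine tsum_congr fun n => ?_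
    push_cast
    ring

theorem polylogRight_eq_polylog (hs : 0 < s.re) (hz : ‖z‖ < 1) :
    polylogRight s z = polylog s z := by
  have hint : ∫ t in Ioo (0 : ℝ) 1, negLogPow s t * (z / (1 - t * z)) =
      mellin (fun x => z * Real.exp (-x) / (1 - z * Real.exp (-x))) s := by
    rw [integral_Ioo_zero_one_eq_exp_neg, mellin]
    refine setIntegral_congr_fun measurableSet_Ioi fun x hx => ?_
    simp only [negLogPow_exp_neg hx, Complex.real_smul, smul_eq_mul]
    ring
  rw [polylogRight, hint, mellin_geometric_eq_Gamma_mul_polylog hs hz, ← mul_assoc,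
    one_div_mul_cancel (Complex.Gamma_ne_zero_of_re_pos hs), one_mul]

theorem one_sub_mul_ne_zero (hz : z ∈ rightSlitPlane) {t : ℝ} (ht : t ∈ Icc (0 : ℝ) 1) :
    (1 - t * z : ℂ) ≠ 0 := by
  have hmem := Complex.starConvex_one_slitPlane hz (sub_nonneg.2 ht.2) ht.1 (sub_add_cancel 1 t)
  have heq : (1 - t * z : ℂ) = (1 - t) • 1 + t • (1 - z) := by
    simp only [Complex.real_smul, Complex.ofReal_sub, Complex.ofReal_one]
    ring
  exact heq ▸ Complex.slitPlane_ne_zero hmem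

theorem continuousOn_div_one_sub_mul : ContinuousOn
    (Function.uncurry fun (z : ℂ) (t : ℝ) => z / (1 - t * z)) (rightSlitPlane ×ˢ Icc 0 1) :=
  ContinuousOn.div (by fun_prop) (by fun_prop) fun x hx => one_sub_mul_ne_zero hx.1 hx.2

theorem analyticOnNhd_polylogRight (hs : 0 < s.re) :
    AnalyticOnNhd ℂ (polylogRight s) rightSlitPlane := by
  refine analyticOnNhd_const.mul (DifferentiableOn.analyticOnNhd ?_ isOpen_rightSlitPlane)
  refine differentiableOn_integral_mul_of_isCompact isOpen_rightSlitPlane isCompact_Icc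
    measurableSet_Ioo Ioo_subset_Icc_self (integrableOn_negLogPow hs) continuousOn_div_one_sub_mul
    fun t ht => ?_
  exact differentiableOn_id.div (by fun_prop)
    fun z hz => one_sub_mul_ne_zero hz (Ioo_subset_Icc_self ht)

theorem inv_mem_doublySlitPlane (hz : z ∈ leftSlitPlane) : z⁻¹ ∈ doublySlitPlane := by
  have hz0 : z ≠ 0 := fun h => leftSlitPlane_subset hz (.inl h)
  have hn : 0 < Complex.normSq z := Complex.normSq_pos.2 hz0
  rw [doublySlitPlane, mem_inter_iff, mem_rightSlitPlane_iff, Complex.mem_slitPlane_iff,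
    Complex.inv_re, Complex.inv_im]
  rcases mem_leftSlitPlane_iff.1 hz with hre | him
  · refine ⟨.inl ?_, .inl (div_pos (by linarith) hn)⟩
    rw [div_lt_one hn, Complex.normSq_apply]
    nlinarith [mul_self_nonneg z.im]
  · have hne : -z.im / Complex.normSq z ≠ 0 := div_ne_zero (neg_ne_zero.2 him) hn.ne'
    exact ⟨.inr hne, .inr hne⟩

theorem ofReal_mem_doublySlitPlane {t : ℝ} (ht : t ∈ Ioo (0 : ℝ) 1) :
    (t : ℂ) ∈ doublySlitPlane :=
  ⟨mem_rightSlitPlane_iff.2 (.inl ht.2), Complex.ofReal_mem_slitPlane.2 ht.1⟩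

theorem analyticOnNhd_polylogLeft (hs : 0 < s.re) :
    AnalyticOnNhd ℂ (polylogLeft s) leftSlitPlane := by
  intro z hz
  have hz' : z⁻¹ ∈ doublySlitPlane := inv_mem_doublySlitPlane hz
  have hinv : AnalyticAt ℂ (fun z : ℂ => z⁻¹) z :=
    analyticAt_inv fun h => leftSlitPlane_subset hz (.inl h)
  have hdslope : AnalyticAt ℂ (fun ζ => ∫ t in Ioo (0 : ℝ) 1, dslope (negLogPow s) t ζ) z⁻¹ :=
    (differentiableOn_integral_dslope isOpen_doublySlitPlane
      (analyticOnNhd_negLogPow s).differentiableOn Complex.measurable_ofReal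
      ((ae_restrict_mem measurableSet_Ioo).mono fun _ ht => ofReal_mem_doublySlitPlane ht)
      (integrableOn_negLogPow hs)).analyticAt
      (isOpen_doublySlitPlane.mem_nhds hz')
  exact analyticAt_const.mul
    ((((analyticOnNhd_negLogPow s _ hz').fun_comp (f := fun z : ℂ => z⁻¹) hinv).mul
      (((hinv.clog hz'.2).sub ((analyticAt_const.sub hinv).clog hz'.1)).add
        analyticAt_const)).sub
      (AnalyticAt.fun_comp (f := fun z : ℂ => z⁻¹) hdslope hinv))

end Polylog

section Jump

variable {s z ζ : ℂ}

theorem sub_ofReal_mem_slitPlane (hζ : ζ.im ≠ 0) (t : ℝ) : ζ - t ∈ Complex.slitPlane :=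
  Complex.mem_slitPlane_iff.2 (.inr (by simpa using hζ))

theorem continuous_inv_sub_ofReal (hζ : ζ.im ≠ 0) : Continuous fun t : ℝ => (ζ - t)⁻¹ :=
  (by fun_prop : Continuous fun t : ℝ => ζ - t).inv₀
    fun t => Complex.slitPlane_ne_zero (sub_ofReal_mem_slitPlane hζ t)

theorem integral_inv_sub_ofReal (hζ : ζ.im ≠ 0) (a b : ℝ) :
    ∫ t in a..b, (ζ - t)⁻¹ = Complex.log (ζ - a) - Complex.log (ζ - b) := by
  have hderiv (t : ℝ) : HasDerivAt (fun t : ℝ => -Complex.log (ζ - t)) (ζ - t)⁻¹ t := by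
    have hsub : HasDerivAt (fun t : ℝ => ζ - (t : ℂ)) (-1) t :=
      (Complex.ofRealCLM.hasDerivAt (x := t)).const_sub ζ
    simpa [neg_div] using (hsub.clog_real (sub_ofReal_mem_slitPlane hζ t)).fun_neg
  rw [intervalIntegral.integral_eq_sub_of_hasDerivAt (fun t _ => hderiv t)
    ((continuous_inv_sub_ofReal hζ).intervalIntegrable _ _)]
  ring

theorem integral_mul_inv_sub_ofReal {ψ : ℂ → ℂ} (hζ : ζ.im ≠ 0)
    (hψ : IntegrableOn (fun t : ℝ => ψ t) (Ioo 0 1)) :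
    ∫ t in Ioo (0 : ℝ) 1, ψ t * (ζ - t)⁻¹ =
      ψ ζ * (Complex.log ζ - Complex.log (ζ - 1)) - ∫ t in Ioo (0 : ℝ) 1, dslope ψ t ζ := by
  have hcont := continuous_inv_sub_ofReal hζ
  have hker : IntegrableOn (fun t : ℝ => ψ ζ * (ζ - t)⁻¹) (Ioo 0 1) :=
    ((hcont.const_mul _).integrableOn_Icc).mono_set Ioo_subset_Icc_self
  have hprod : IntegrableOn (fun t : ℝ => ψ t * (ζ - t)⁻¹) (Ioo 0 1) :=
    hψ.mul_continuousOn_of_subset hcont.continuousOn measurableSet_Ioo isCompact_Icc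
      Ioo_subset_Icc_self
  have hdslope (t : ℝ) : dslope ψ t ζ = ψ ζ * (ζ - t)⁻¹ - ψ t * (ζ - t)⁻¹ := by
    rw [dslope_of_ne _ fun h => hζ (by simp [h]), slope_def_field]
    ring
  have hlog : ∫ t in Ioo (0 : ℝ) 1, (ζ - t)⁻¹ = Complex.log ζ - Complex.log (ζ - 1) := by
    simpa [← integral_Ioc_eq_integral_Ioo, intervalIntegral.integral_of_le] using
      integral_inv_sub_ofReal hζ 0 1
  simp only [hdslope]
  rw [integral_sub hker hprod, integral_const_mul, hlog, sub_sub_cancel]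

theorem inv_im_pos (hz : z.im < 0) : 0 < (z⁻¹).im := by
  rw [Complex.inv_im]
  exact div_pos (neg_pos.2 hz) (Complex.normSq_pos.2 fun h => hz.ne (by simp [h]))

theorem inv_im_neg (hz : 0 < z.im) : (z⁻¹).im < 0 := by
  simpa using inv_im_pos (z := -z) (by simpa using hz)

theorem polylogRight_eq_of_im_ne_zero (hs : 0 < s.re) (hz : z.im ≠ 0) :
    polylogRight s z = 1 / Complex.Gamma s *
      (negLogPow s z⁻¹ * (Complex.log z⁻¹ - Complex.log (z⁻¹ - 1)) -
        ∫ t in Ioo (0 : ℝ) 1, dslope (negLogPow s) t z⁻¹) := by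
  have hz0 : z ≠ 0 := fun h => hz (by simp [h])
  have hζ : (z⁻¹).im ≠ 0 := hz.lt_or_gt.elim (fun h => (inv_im_pos h).ne')
    fun h => (inv_im_neg h).ne
  have hker (t : ℝ) : z / (1 - t * z) = (z⁻¹ - t)⁻¹ := by
    rw [← inv_div, sub_div, one_div, mul_div_cancel_right₀ _ hz0]
  simp only [polylogRight, hker]
  rw [integral_mul_inv_sub_ofReal hζ (integrableOn_negLogPow hs)]

theorem polylogRight_eq_polylogLeft_of_im_pos (hs : 0 < s.re) (hz : 0 < z.im) :
    polylogRight s z = polylogLeft s z := by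
  rw [polylogRight_eq_of_im_ne_zero hs hz.ne', polylogLeft, ← neg_sub 1 z⁻¹,
    log_neg_of_im_pos (by simpa using inv_im_neg hz)]
  ring

theorem polylogRight_eq_polylogLeft_of_im_neg (hs : 0 < s.re) (hz : z.im < 0) :
    polylogRight s z =
      polylogLeft s z - 2 * Real.pi * Complex.I / Complex.Gamma s * negLogPow s z⁻¹ := by
  rw [polylogRight_eq_of_im_ne_zero hs hz.ne, polylogLeft, ← neg_sub 1 z⁻¹,
    log_neg_of_im_neg (by simpa using inv_im_pos hz)]
  ring

end Jump

section PolylogGerms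

variable {s b z w : ℂ}

/-- The germs at `b` of the functions `(log z) ^ (s - 1)`, for all determinations of the logarithm
and of the power. -/
def logPowGerms (s b : ℂ) : Set (ℂ → ℂ) :=
  (fun m z => Complex.exp ((s - 1) * m z)) '' logGerms (logGerms fun _ => {id}) b

theorem germsExtendLocally_logPowGerms (s : ℂ) :
    GermsExtendLocally (logPowGerms s) {0, 1}ᶜ := by
  intro a ha
  obtain ⟨r, hr, hball⟩ :=
    Metric.isOpen_iff.1 (toFinite ({0, 1} : Set ℂ)).isClosed.isOpen_compl a ha
  have hid : GermsExtendOn (fun _ => {id}) (ball a r) := fun _ _ f hf =>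
    ⟨id, analyticOnNhd_id, .of_eq hf.symm, fun _ _ => rfl⟩
  have hlog : GermsExtendOn (logGerms fun _ => {id}) (ball a r) :=
    hid.logGerms fun b hb f hf hb0 => hball hb (.inl (by simpa [mem_singleton_iff.1 hf] using hb0))
  have hloglog : GermsExtendOn (logGerms (logGerms fun _ => {id})) (ball a r) := by
    refine hlog.logGerms ?_
    rintro b hb f ⟨-, _, rfl, hexp⟩ hb0
    exact hball hb (.inr (by simpa [hb0] using hexp.self_of_nhds.symm))
  exact ⟨r, hr, hloglog.image_comp (φ := fun m => Complex.exp ((s - 1) * m)) (by fun_prop)⟩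

theorem negLogPow_inv_mem_logPowGerms (hb : b ∈ leftSlitPlane) :
    (fun z => negLogPow s z⁻¹) ∈ logPowGerms s b := by
  have hinv : AnalyticAt ℂ (fun z : ℂ => z⁻¹) b :=
    analyticAt_inv fun h => leftSlitPlane_subset hb (.inl h)
  refine ⟨fun z => Complex.log (-Complex.log z⁻¹),
    ⟨(analyticAt_log_neg_log (inv_mem_doublySlitPlane hb)).fun_comp (f := fun z : ℂ => z⁻¹) hinv,
      fun z => -Complex.log z⁻¹, ⟨(hinv.clog (inv_mem_doublySlitPlane hb).2).neg, id, rfl, ?_⟩, ?_⟩,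
    rfl⟩
  all_goals
    filter_upwards [isOpen_leftSlitPlane.mem_nhds hb] with z hz
  · rw [Complex.exp_neg, Complex.exp_log (Complex.slitPlane_ne_zero (inv_mem_doublySlitPlane hz).2),
      inv_inv, id]
  · exact Complex.exp_log (Complex.slitPlane_ne_zero
      (neg_log_mem_slitPlane (inv_mem_doublySlitPlane hz)))

theorem powDet_pi (z a : ℂ) :
    powDet Real.pi z a = Complex.exp (a * (Complex.log (-z) + Real.pi * Complex.I)) := by
  rw [powDet, logDet, Complex.exp_neg, Complex.exp_pi_mul_I, inv_neg, inv_one, mul_neg_one]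

theorem powDet_zero (z a : ℂ) : powDet 0 z a = Complex.exp (a * Complex.log z) := by
  simp [powDet, logDet]

theorem powDet_pi_log_mem_logPowGerms (hb : b ∈ doublySlitPlane) :
    (fun z => powDet Real.pi (Complex.log z) (s - 1)) ∈ logPowGerms s b := by
  refine ⟨fun z => Complex.log (-Complex.log z) + Real.pi * Complex.I,
    ⟨(analyticAt_log_neg_log hb).add analyticAt_const,
      Complex.log, ⟨analyticAt_clog hb.2, id, rfl, ?_⟩, ?_⟩, funext fun z => (powDet_pi _ _).symm⟩
  all_goals
    filter_upwards [isOpen_doublySlitPlane.mem_nhds hb] with z hz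
  · exact Complex.exp_log (Complex.slitPlane_ne_zero hz.2)
  · rw [Complex.exp_add, Complex.exp_pi_mul_I, mul_neg_one,
      Complex.exp_log (Complex.slitPlane_ne_zero (neg_log_mem_slitPlane hz)), neg_neg]

theorem negLogPow_inv_eq_powDet_pi_log (hz : 0 < z.im) :
    negLogPow s z⁻¹ = powDet Real.pi (Complex.log z) (s - 1) := by
  have harg : z.arg ≠ Real.pi := fun h => hz.ne' (Complex.arg_eq_pi_iff.1 h).2
  have hlog : 0 < (Complex.log z).im := by
    rw [Complex.log_im]
    exact (Complex.arg_nonneg_iff.2 hz.le).lt_of_ne fun h =>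
      hz.ne' (Complex.arg_eq_zero_iff.1 h.symm).2
  rw [powDet_pi, log_neg_of_im_pos hlog, negLogPow, Complex.log_inv _ harg, neg_neg, sub_add_cancel]

/-- The germs at `b` of `polylogRight s + h` and `polylogLeft s + h`, for `h` in the span of
`logPowGerms s b`: these contain all the continuations of the polylogarithm. -/
def polylogGerms (s : ℂ) : ℂ → Set (ℂ → ℂ) :=
  translateGerms ![rightSlitPlane, leftSlitPlane] ![polylogRight s, polylogLeft s]
    fun b => Submodule.span ℂ (logPowGerms s b)

theorem exists_mem_span_polylogRight_eq (hs : 0 < s.re)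
    (hb : b ∈ rightSlitPlane ∩ leftSlitPlane) :
    ∃ h ∈ Submodule.span ℂ (logPowGerms s b), polylogRight s =ᶠ[𝓝 b] polylogLeft s + h := by
  have him : b.im ≠ 0 := fun h => by
    have hlt := (mem_rightSlitPlane_iff.1 hb.1).resolve_right (not_not.2 h)
    exact hlt.not_gt ((mem_leftSlitPlane_iff.1 hb.2).resolve_right (not_not.2 h))
  rcases him.lt_or_gt with hneg | hpos
  · refine ⟨-(2 * Real.pi * Complex.I / Complex.Gamma s) • fun z => negLogPow s z⁻¹,
      Submodule.smul_mem _ _ (Submodule.subset_span (negLogPow_inv_mem_logPowGerms hb.2)), ?_⟩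
    filter_upwards [(isOpen_Iio.preimage Complex.continuous_im).mem_nhds hneg] with z hz
    simp [polylogRight_eq_polylogLeft_of_im_neg hs hz, sub_eq_add_neg]
  · refine ⟨0, Submodule.zero_mem _, ?_⟩
    filter_upwards [(isOpen_Ioi.preimage Complex.continuous_im).mem_nhds hpos] with z hz
    simp [polylogRight_eq_polylogLeft_of_im_pos hs hz]

theorem germsExtendLocally_polylogGerms (hs : 0 < s.re) :
    GermsExtendLocally (polylogGerms s) {0, 1}ᶜ := by
  refine GermsExtendLocally.translateGerms (fun a ha => ?_) ?_ (fun z hz => ?_) ?_ ?_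
  · obtain ⟨r, hr, hext⟩ := germsExtendLocally_logPowGerms s a ha
    exact ⟨r, hr, hext.span⟩
  · exact Fin.forall_fin_two.2 ⟨isOpen_rightSlitPlane, isOpen_leftSlitPlane⟩
  · rcases mem_rightSlitPlane_or_mem_leftSlitPlane (mt .inr hz) with h | h
    exacts [mem_iUnion.2 ⟨0, h⟩, mem_iUnion.2 ⟨1, h⟩]
  · exact Fin.forall_fin_two.2 ⟨analyticOnNhd_polylogRight hs, analyticOnNhd_polylogLeft hs⟩
  · refine Fin.forall_fin_two.2 ⟨Fin.forall_fin_two.2 ⟨fun b _ => ?_, fun b hb => ?_⟩,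
      Fin.forall_fin_two.2 ⟨fun b hb => ?_, fun b _ => ?_⟩⟩
    · exact ⟨0, Submodule.zero_mem _, by rw [add_zero]⟩
    · exact exists_mem_span_polylogRight_eq hs hb
    · obtain ⟨h, hh, heq⟩ := exists_mem_span_polylogRight_eq hs hb.symm
      refine ⟨-h, Submodule.neg_mem _ hh, ?_⟩
      filter_upwards [heq] with z hz
      exact eq_add_neg_of_add_eq hz.symm
    · exact ⟨0, Submodule.zero_mem _, by rw [add_zero]⟩

theorem polylogRight_sub_mem_polylogGerms (hb : b ∈ rightSlitPlane) {h : ℂ → ℂ}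
    (hh : h ∈ Submodule.span ℂ (logPowGerms s b)) :
    (fun z => polylogRight s z - h z) ∈ polylogGerms s b :=
  ⟨0, hb, -h, Submodule.neg_mem _ hh, .of_forall fun _ => sub_eq_add_neg _ _⟩

theorem polylogLeft_sub_mem_polylogGerms (hb : b ∈ leftSlitPlane) {h : ℂ → ℂ}
    (hh : h ∈ Submodule.span ℂ (logPowGerms s b)) :
    (fun z => polylogLeft s z - h z) ∈ polylogGerms s b :=
  ⟨1, hb, -h, Submodule.neg_mem _ hh, .of_forall fun _ => sub_eq_add_neg _ _⟩

theorem polylogRight_eventuallyEq_polylog (hs : 0 < s.re) (hw : ‖w‖ < 1) :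
    polylogRight s =ᶠ[𝓝 w] polylog s := by
  filter_upwards [isOpen_ball.mem_nhds (mem_ball_zero_iff.2 hw)] with z hz
  exact polylogRight_eq_polylog hs (mem_ball_zero_iff.1 hz)

theorem IsLoopAboutOne.continuesAlong_polylog {γ : Path w w} (hγ : IsLoopAboutOne γ)
    (hs : 0 < s.re) (hw : ‖w‖ < 1) (hw' : w ∈ Complex.slitPlane) :
    ContinuesAlong (polylogGerms s) γ (polylog s) fun z => polylog s z -
      2 * Real.pi * Complex.I / Complex.Gamma s * powDet Real.pi (Complex.log z) (s - 1) := by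
  set κ : ℂ := 2 * Real.pi * Complex.I / Complex.Gamma s
  obtain ⟨g, hg, hgP, h0, h1⟩ := hγ.continuesAlong
    (F := ![polylogRight s, fun z => polylogLeft s z - κ * negLogPow s z⁻¹,
      fun z => polylogRight s z - κ * powDet Real.pi (Complex.log z) (s - 1)])
    (germsExtendLocally_polylogGerms hs)
    ⟨ball_subset_rightSlitPlane (mem_ball_zero_iff.2 hw), hw'⟩
    (fun z hz => ⟨0, hz.1, 0, Submodule.zero_mem _, by rw [add_zero]; rfl⟩)
    (fun z hz => polylogLeft_sub_mem_polylogGerms hz (Submodule.smul_mem _ κ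
      (Submodule.subset_span (negLogPow_inv_mem_logPowGerms hz))))
    (fun z hz => polylogRight_sub_mem_polylogGerms hz.1 (Submodule.smul_mem _ κ
      (Submodule.subset_span (powDet_pi_log_mem_logPowGerms hz))))
    (fun z hz => polylogRight_eq_polylogLeft_of_im_neg hs hz)
    (fun z hz => congrArg₂ (· - κ * ·) (polylogRight_eq_polylogLeft_of_im_pos hs hz).symm
      (negLogPow_inv_eq_powDet_pi_log hz))
  have hpolylog := polylogRight_eventuallyEq_polylog hs hw
  exact ⟨g, hg, hgP, h0.trans hpolylog, h1.trans (hpolylog.sub .rfl)⟩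

end PolylogGerms

section SegmentIntegrals

variable {s z : ℂ} {t : ℝ}

theorem curveIntegralFun_formDlog_segment_zero (hz : z ≠ 0) (ht : t ∈ Icc (0 : ℝ) 1) :
    curveIntegralFun formDlog (Path.segment 0 z) t = (t⁻¹ : ℝ) := by
  rw [curveIntegralFun_segment _ _ _ ht]
  suffices z⁻¹ * (t : ℂ)⁻¹ * z = (t : ℂ)⁻¹ by
    simpa [AffineMap.lineMap_apply_module', formDlog]
  rw [mul_right_comm, inv_mul_cancel₀ hz, one_mul]

theorem curveIntegralFun_formOne_segment_zero (z : ℂ) (ht : t ∈ Icc (0 : ℝ) 1) :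
    curveIntegralFun formOne (Path.segment 0 z) t = z / (1 - t * z) := by
  rw [curveIntegralFun_segment _ _ _ ht]
  simp [AffineMap.lineMap_apply_module', formOne, div_eq_inv_mul]

theorem intervalIntegrable_formDlog_segment_zero (hz : z ≠ 0) (ht : t ∈ Ioo (0 : ℝ) 1) :
    IntervalIntegrable (curveIntegralFun formDlog (Path.segment 0 z)) volume t 1 := by
  have hinv : ContinuousOn (fun u : ℝ => ((u⁻¹ : ℝ) : ℂ)) (Icc t 1) :=
    Complex.continuous_ofReal.comp_continuousOn
      (continuousOn_inv₀.mono fun u hu => (ht.1.trans_le hu.1).ne')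
  refine (hinv.intervalIntegrable_of_Icc ht.2.le).congr fun u hu => ?_
  rw [uIoc_of_le ht.2.le] at hu
  exact (curveIntegralFun_formDlog_segment_zero hz ⟨(ht.1.trans hu.1).le, hu.2⟩).symm

theorem integral_formDlog_segment_zero (hz : z ≠ 0) (ht : t ∈ Ioo (0 : ℝ) 1) :
    ∫ u in t..1, curveIntegralFun formDlog (Path.segment 0 z) u = -Complex.log t := by
  have hcongr : EqOn (curveIntegralFun formDlog (Path.segment 0 z)) (fun u => (u⁻¹ : ℝ))
      (uIcc t 1) := fun u hu => by
    rw [uIcc_of_le ht.2.le] at hu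
    exact curveIntegralFun_formDlog_segment_zero hz ⟨ht.1.le.trans hu.1, hu.2⟩
  rw [intervalIntegral.integral_congr hcongr, intervalIntegral.integral_ofReal,
    integral_inv_of_pos ht.1 one_pos, one_div, Real.log_inv, Complex.ofReal_neg,
    Complex.ofReal_log ht.1.le]

theorem iterIntegrand_segment_zero (hz : z ≠ 0) (ht : t ∈ Ioo (0 : ℝ) 1) :
    iterIntegrand 0 formOne formDlog (Path.segment 0 z) s t =
      1 / Complex.Gamma s * (negLogPow s t * (z / (1 - t * z))) := by
  rw [iterIntegrand, integral_formDlog_segment_zero hz ht,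
    curveIntegralFun_formOne_segment_zero z (Ioo_subset_Icc_self ht), powDet_zero, negLogPow,
    mul_assoc]

theorem iterIntegrable_segment_zero (hs : 0 < s.re) (hz : z ≠ 0) (hz' : z ∈ rightSlitPlane) :
    IterIntegrable 0 formOne formDlog (Path.segment 0 z) s := by
  refine ⟨fun t ht => intervalIntegrable_formDlog_segment_zero hz ht, ?_⟩
  have hker : ContinuousOn (fun t : ℝ => z / (1 - t * z)) (Icc 0 1) :=
    continuousOn_div_one_sub_mul.comp (f := fun t => (z, t)) (by fun_prop) fun _ ht => ⟨hz', ht⟩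
  have hint := ((integrableOn_negLogPow hs).mul_continuousOn_of_subset hker measurableSet_Ioo
    isCompact_Icc Ioo_subset_Icc_self).const_mul (1 / Complex.Gamma s)
  rw [intervalIntegrable_iff_integrableOn_Ioo_of_le zero_le_one]
  exact IntegrableOn.congr_fun hint (fun t ht => (iterIntegrand_segment_zero hz ht).symm)
    measurableSet_Ioo

theorem iterIntegral_segment_zero (hz : z ≠ 0) :
    iterIntegral 0 formOne formDlog (Path.segment 0 z) s = polylogRight s z := by
  rw [iterIntegral, intervalIntegral.integral_of_le zero_le_one, integral_Ioc_eq_integral_Ioo,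
    setIntegral_congr_fun measurableSet_Ioo fun t ht => iterIntegrand_segment_zero hz ht,
    integral_const_mul, polylogRight]

theorem formDlog_lineMap_one (z : ℂ) (t : ℝ) :
    formDlog (AffineMap.lineMap 1 z t) (z - 1) = (z - 1) * (1 + t • (z - 1))⁻¹ := by
  simp [formDlog, AffineMap.lineMap_apply_module', mul_comm, add_comm]

theorem curveIntegrable_formDlog_segment_one (hz : z ∈ Complex.slitPlane) :
    CurveIntegrable formDlog (Path.segment 1 z) := by
  rw [curveIntegrable_segment]
  simp only [formDlog_lineMap_one]
  exact (continuousOn_const.mul (Complex.continuousOn_one_add_mul_inv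
    (by simpa using hz))).intervalIntegrable_of_Icc zero_le_one

theorem curveIntegral_formDlog_segment_one (hz : z ∈ Complex.slitPlane) :
    curveIntegral formDlog (Path.segment 1 z) = Complex.log z := by
  rw [curveIntegral_segment]
  simp only [formDlog_lineMap_one]
  rw [intervalIntegral.integral_const_mul, ← Complex.log_eq_integral (by simpa using hz),
    add_sub_cancel]

end SegmentIntegrals

theorem mainTheorem5_general (s : ℂ) (hs : 0 < s.re) (w : ℂ) (hw : ‖w‖ < 1)
    (hw' : w ∈ Complex.slitPlane) (γ : Path w w) (hγ : IsPiecewiseC1 γ)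
    (hloop : IsLoopAboutOne γ) :
    (∃ g : I → ℂ → ℂ, IsAnalyticContinuationAlong γ g ∧ g 0 =ᶠ[𝓝 w] polylog s) ∧
    (∀ g : I → ℂ → ℂ, IsAnalyticContinuationAlong γ g → g 0 =ᶠ[𝓝 w] polylog s →
      g 1 =ᶠ[𝓝 w] fun z => polylog s z -
        2 * Real.pi * Complex.I / Complex.Gamma s * powDet Real.pi (Complex.log z) (s - 1)) ∧
    CurveIntegrable formOne γ ∧
    ∀ z : ℂ, ‖z‖ < 1 → z ∈ Complex.slitPlane →
      IterIntegrable 0 formOne formDlog (Path.segment 0 z) s ∧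
      CurveIntegrable formDlog (Path.segment 1 z) ∧
      polylog s z -
          2 * Real.pi * Complex.I / Complex.Gamma s * powDet Real.pi (Complex.log z) (s - 1) =
        iterIntegral 0 formOne formDlog (Path.segment 0 z) s +
          curveIntegral formOne γ * powIntegral Real.pi formDlog (Path.segment 1 z) s := by
  have hcont := hloop.continuesAlong_polylog hs hw hw'
  have hball {z : ℂ} (hz : ‖z‖ < 1) : z ∈ rightSlitPlane :=
    ball_subset_rightSlitPlane (mem_ball_zero_iff.2 hz)
  refine ⟨?_, fun g hg hg0 => hcont.eventuallyEq hg hg0, hloop.curveIntegrable_formOne hγ,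
    fun z hz hz' => ?_⟩
  · obtain ⟨g, hg, -, hg0, -⟩ := hcont
    exact ⟨g, hg, hg0⟩
  · have hz0 : z ≠ 0 := Complex.slitPlane_ne_zero hz'
    refine ⟨iterIntegrable_segment_zero hs hz0 (hball hz),
      curveIntegrable_formDlog_segment_one hz', ?_⟩
    rw [iterIntegral_segment_zero hz0, polylogRight_eq_polylog hs hz, powIntegral,
      curveIntegral_formDlog_segment_one hz', hloop.curveIntegral_formOne hγ ⟨hball hw, hw'⟩]
    ring

theorem mainTheorem5 (s : ℂ) (hs : 1 < s.re) (w : ℂ) (hw : ‖w‖ < 1) (hw' : w ∈ Complex.slitPlane)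
    (γ : Path w w) (hγ : IsPiecewiseC1 γ) (hloop : IsLoopAboutOne γ) :
    (∃ g : I → ℂ → ℂ, IsAnalyticContinuationAlong γ g ∧ g 0 =ᶠ[𝓝 w] polylog s) ∧
    (∀ g : I → ℂ → ℂ, IsAnalyticContinuationAlong γ g → g 0 =ᶠ[𝓝 w] polylog s →
      g 1 =ᶠ[𝓝 w] fun z => polylog s z -
        2 * Real.pi * Complex.I / Complex.Gamma s * powDet Real.pi (Complex.log z) (s - 1)) ∧
    CurveIntegrable formOne γ ∧
    ∀ z : ℂ, ‖z‖ < 1 → z ∈ Complex.slitPlane →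
      IterIntegrable 0 formOne formDlog (Path.segment 0 z) s ∧
      CurveIntegrable formDlog (Path.segment 1 z) ∧
      polylog s z -
          2 * Real.pi * Complex.I / Complex.Gamma s * powDet Real.pi (Complex.log z) (s - 1) =
        iterIntegral 0 formOne formDlog (Path.segment 0 z) s +
          curveIntegral formOne γ * powIntegral Real.pi formDlog (Path.segment 1 z) s :=
  mainTheorem5_general s (zero_lt_one.trans hs) w hw hw' γ hγ hloop
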